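/- Let $n\ge 1$ and let $\Omega\subset\mathbb{C}^n$ be a Reinhardt domain, bounded or not, i.e. a nonempty connected open set such that $(\lambda_1z_1,\dots,\lambda_nz_n)\in\Omega$ whenever $z\in\Omega$ and $|\lambda_1|=\dots=|\lambda_n|=1$. Let $\mathcal{A}^\infty(\Omega)$ be the space of holomorphic functions $f$ on $\Omega$ all of whose derivatives $D^\beta f=\partial^{\beta_1+\dots+\beta_n}f/\partial z_1^{\beta_1}\cdots\partial z_n^{\beta_n}$, $\beta\in\mathbb{N}^n$, extend continuously to $\overline{\Omega}$, with the locally convex (Fréchet) topology generated by the seminorms $$\|f\|_{k,\Omega_m}=\sup\{|D^\beta f(z)| : z\in\Omega_m,\ \beta_1+\dots+\beta_n\le k\},\qquad \Omega_m=\{z\in\Omega : |z_j|<m \text{ for all } j\},\qquad k,m\in\mathbb{N}.$$ Let $f\in\mathcal{A}^\infty(\Omega)$. Then the Laurent series $\sum_{\alpha\in\mathbb{Z}^n}c_\alpha z^\alpha$ of $f$, whose coefficients are $$c_\alpha=\frac{1}{(2\pi i)^n}\int_{|\zeta_1|=|w_1|}\cdots\int_{|\zeta_n|=|w_n|}\frac{f(\zeta)}{\zeta^\alpha}\,\frac{d\zeta_n}{\zeta_n}\cdots\frac{d\zeta_1}{\zeta_1}$$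 for every $w\in\Omega$ with $w_1\cdots w_n\ne 0$ (independently of $w$), has all its terms in $\mathcal{A}^\infty(\Omega)$ and converges unconditionally to $f$ in the topology of $\mathcal{A}^\infty(\Omega)$: for every bijection $\sigma:\mathbb{N}\to\mathbb{Z}^n$, the partial sums of $\sum_{j=0}^\infty c_{\sigma(j)}z^{\sigma(j)}$ converge to $f$ in $\mathcal{A}^\infty(\Omega)$. Moreover, the series converges absolutely in $\mathcal{A}^\infty(\Omega)$: there is a bijection $\sigma:\mathbb{N}\to\mathbb{Z}^n$ such that $\sum_{j=0}^\infty p(c_{\sigma(j)}z^{\sigma(j)})<\infty$ for every continuous seminorm $p$ on $\mathcal{A}^\infty(\Omega)$. -/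

import Mathlib

open Filter Topology

noncomputable section

namespace LaurentAInfty

/-- A Reinhardt domain in `ℂⁿ`: a (nonempty) open connected set that is invariant under the
rotations `z ↦ (lam₁ z₁, …, lamₙ zₙ)`, `|lamⱼ| = 1`. -/
structure IsReinhardtDomain {n : ℕ} (Ω : Set (Fin n → ℂ)) : Prop where
  isOpen : IsOpen Ω
  isConnected : IsConnected Ω
  rotate_mem : ∀ z ∈ Ω, ∀ lam : Fin n → ℂ, (∀ j, ‖lam j‖ = 1) → (fun j => lam j * z j) ∈ Ω

/-- The partial derivative `∂g/∂zⱼ`. -/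
def pderiv {n : ℕ} (j : Fin n) (g : (Fin n → ℂ) → ℂ) : (Fin n → ℂ) → ℂ :=
  fun z => fderiv ℂ g z (Pi.single j 1)

/-- `(∂/∂z_{j₁})^{α_{j₁}} (∂/∂z_{j₂})^{α_{j₂}} ⋯ g`, for a list `j₁, j₂, …` of variables. -/
def mderivList {n : ℕ} (α : Fin n → ℕ) (l : List (Fin n)) (g : (Fin n → ℂ) → ℂ) :
    (Fin n → ℂ) → ℂ :=
  l.foldr (fun j h => (pderiv j)^[α j] h) g

/-- `D^α g = ∂^{α₁ + ⋯ + αₙ} g / ∂z₁^{α₁} ⋯ ∂zₙ^{αₙ}`. -/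
def mderiv {n : ℕ} (α : Fin n → ℕ) (g : (Fin n → ℂ) → ℂ) : (Fin n → ℂ) → ℂ :=
  mderivList α (List.finRange n) g

/-- Extension by zero of a function on `Ω` to `ℂⁿ`. On an open `Ω`, its values and derivatives
at the points of `Ω` are those of the function. -/
def zeroExt {n : ℕ} {Ω : Set (Fin n → ℂ)} (f : Ω → ℂ) : (Fin n → ℂ) → ℂ :=
  Function.extend Subtype.val f 0

theorem zeroExt_apply {n : ℕ} {Ω : Set (Fin n → ℂ)} (f : Ω → ℂ) (z : Ω) :
    zeroExt f z = f z :=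
  Subtype.val_injective.extend_apply f 0 z

theorem zeroExt_of_notMem {n : ℕ} {Ω : Set (Fin n → ℂ)} (f : Ω → ℂ) {z : Fin n → ℂ}
    (hz : z ∉ Ω) : zeroExt f z = 0 := by
  unfold zeroExt
  rw [Function.extend_apply']
  · rfl
  · rintro ⟨a, rfl⟩
    exact hz a.2

theorem zeroExt_add {n : ℕ} {Ω : Set (Fin n → ℂ)} (f g : Ω → ℂ) :
    zeroExt (f + g) = zeroExt f + zeroExt g := by
  ext z
  by_cases hz : z ∈ Ω
  · have h := zeroExt_apply (f + g) ⟨z, hz⟩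
    have hf := zeroExt_apply f ⟨z, hz⟩
    have hg := zeroExt_apply g ⟨z, hz⟩
    simp only [Pi.add_apply] at *
    rw [h, hf, hg]
  · simp [zeroExt_of_notMem _ hz]

theorem zeroExt_smul {n : ℕ} {Ω : Set (Fin n → ℂ)} (a : ℂ) (f : Ω → ℂ) :
    zeroExt (a • f) = a • zeroExt f := by
  ext z
  by_cases hz : z ∈ Ω
  · have h := zeroExt_apply (a • f) ⟨z, hz⟩
    have hf := zeroExt_apply f ⟨z, hz⟩
    simp only [Pi.smul_apply] at *
    rw [h, hf]
  · simp [zeroExt_of_notMem _ hz]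

theorem zeroExt_zero {n : ℕ} {Ω : Set (Fin n → ℂ)} : zeroExt (0 : Ω → ℂ) = 0 := by
  have h := zeroExt_smul (0 : ℂ) (0 : Ω → ℂ)
  simpa using h

/-! Linearity of `D^α` on analytic functions. -/

theorem analyticAt_pderiv {n : ℕ} (j : Fin n) {g : (Fin n → ℂ) → ℂ} {z : Fin n → ℂ}
    (hg : AnalyticAt ℂ g z) : AnalyticAt ℂ (pderiv j g) z :=
  ((ContinuousLinearMap.apply ℂ ℂ (Pi.single j 1 : Fin n → ℂ)).analyticAt _).comp hg.fderiv

theorem analyticAt_pderiv_iterate {n : ℕ} (j : Fin n) (k : ℕ) {g : (Fin n → ℂ) → ℂ}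
    {z : Fin n → ℂ} (hg : AnalyticAt ℂ g z) : AnalyticAt ℂ ((pderiv j)^[k] g) z := by
  induction k with
  | zero => exact hg
  | succ k ih =>
    rw [Function.iterate_succ_apply']
    exact analyticAt_pderiv j ih

theorem analyticAt_mderivList {n : ℕ} (α : Fin n → ℕ) (l : List (Fin n))
    {g : (Fin n → ℂ) → ℂ} {z : Fin n → ℂ} (hg : AnalyticAt ℂ g z) :
    AnalyticAt ℂ (mderivList α l g) z := by
  induction l with
  | nil => exact hg
  | cons j l ih => exact analyticAt_pderiv_iterate j (α j) ih

theorem analyticAt_mderiv {n : ℕ} (α : Fin n → ℕ) {g : (Fin n → ℂ) → ℂ} {z : Fin n → ℂ}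
    (hg : AnalyticAt ℂ g z) : AnalyticAt ℂ (mderiv α g) z :=
  analyticAt_mderivList α _ hg

theorem pderiv_congr {n : ℕ} (j : Fin n) {g h : (Fin n → ℂ) → ℂ} {z : Fin n → ℂ}
    (hgh : g =ᶠ[𝓝 z] h) : pderiv j g =ᶠ[𝓝 z] pderiv j h := by
  filter_upwards [hgh.fderiv (𝕜 := ℂ)] with w hw
  simp only [pderiv, hw]

theorem pderiv_linear {n : ℕ} (j : Fin n) (a : ℂ) {g h : (Fin n → ℂ) → ℂ} {z : Fin n → ℂ}
    (hg : AnalyticAt ℂ g z) (hh : AnalyticAt ℂ h z) :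
    pderiv j (g + a • h) =ᶠ[𝓝 z] pderiv j g + a • pderiv j h := by
  filter_upwards [hg.eventually_analyticAt, hh.eventually_analyticAt] with w hgw hhw
  simp only [pderiv, Pi.add_apply, Pi.smul_apply]
  rw [fderiv_add hgw.differentiableAt (hhw.differentiableAt.const_smul a),
    fderiv_const_smul hhw.differentiableAt]
  rfl

theorem pderiv_iterate_linear {n : ℕ} (j : Fin n) (k : ℕ) (a : ℂ)
    {f g h : (Fin n → ℂ) → ℂ} {z : Fin n → ℂ}
    (hg : AnalyticAt ℂ g z) (hh : AnalyticAt ℂ h z) (hf : f =ᶠ[𝓝 z] g + a • h) :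
    (pderiv j)^[k] f =ᶠ[𝓝 z] (pderiv j)^[k] g + a • (pderiv j)^[k] h := by
  induction k with
  | zero => exact hf
  | succ k ih =>
    simp only [Function.iterate_succ_apply']
    exact (pderiv_congr j ih).trans (pderiv_linear j a
      (analyticAt_pderiv_iterate j k hg) (analyticAt_pderiv_iterate j k hh))

theorem mderivList_linear {n : ℕ} (α : Fin n → ℕ) (l : List (Fin n)) (a : ℂ)
    {g h : (Fin n → ℂ) → ℂ} {z : Fin n → ℂ}
    (hg : AnalyticAt ℂ g z) (hh : AnalyticAt ℂ h z) :
    mderivList α l (g + a • h) =ᶠ[𝓝 z] mderivList α l g + a • mderivList α l h := by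
  induction l with
  | nil => exact EventuallyEq.rfl
  | cons j l ih =>
    exact pderiv_iterate_linear j (α j) a (analyticAt_mderivList α l hg)
      (analyticAt_mderivList α l hh) ih

theorem mderiv_linear {n : ℕ} (α : Fin n → ℕ) (a : ℂ) {g h : (Fin n → ℂ) → ℂ}
    {z : Fin n → ℂ} (hg : AnalyticAt ℂ g z) (hh : AnalyticAt ℂ h z) :
    mderiv α (g + a • h) z = mderiv α g z + a * mderiv α h z :=
  (mderivList_linear α _ a hg hh).eq_of_nhds

theorem mderiv_add {n : ℕ} (α : Fin n → ℕ) {g h : (Fin n → ℂ) → ℂ}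
    {z : Fin n → ℂ} (hg : AnalyticAt ℂ g z) (hh : AnalyticAt ℂ h z) :
    mderiv α (g + h) z = mderiv α g z + mderiv α h z := by
  simpa using mderiv_linear α 1 hg hh

theorem mderiv_zero {n : ℕ} (α : Fin n → ℕ) (z : Fin n → ℂ) :
    mderiv α (0 : (Fin n → ℂ) → ℂ) z = 0 := by
  have h0 : AnalyticAt ℂ (0 : (Fin n → ℂ) → ℂ) z := analyticAt_const
  simpa using mderiv_add α h0 h0

theorem mderiv_smul {n : ℕ} (α : Fin n → ℕ) (a : ℂ) {h : (Fin n → ℂ) → ℂ}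
    {z : Fin n → ℂ} (hh : AnalyticAt ℂ h z) :
    mderiv α (a • h) z = a * mderiv α h z := by
  have h0 : AnalyticAt ℂ (0 : (Fin n → ℂ) → ℂ) z := analyticAt_const
  simpa [mderiv_zero] using mderiv_linear α a h0 hh

/-- `f : Ω → ℂ` is holomorphic and each of its derivatives `D^α f` extends continuously to the
closure of `Ω`. -/
structure IsAInfty {n : ℕ} (Ω : Set (Fin n → ℂ)) (f : Ω → ℂ) : Prop where
  holo : AnalyticOnNhd ℂ (zeroExt f) Ω
  ext : ∀ α : Fin n → ℕ, ∃ g : (Fin n → ℂ) → ℂ,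
    ContinuousOn g (closure Ω) ∧ ∀ z ∈ Ω, g z = mderiv α (zeroExt f) z

/-- The functions holomorphic on `Ω` and smooth up to the boundary, as a linear subspace of all
functions on `Ω`. -/
def aInftySubmodule {n : ℕ} (Ω : Set (Fin n → ℂ)) : Submodule ℂ (Ω → ℂ) where
  carrier := {f | IsAInfty Ω f}
  zero_mem' := by
    refine ⟨?_, fun α => ⟨0, continuousOn_const, fun z _ => ?_⟩⟩
    · rw [zeroExt_zero]
      exact fun z _ => analyticAt_const
    · rw [zeroExt_zero, mderiv_zero]
      rfl
  add_mem' := by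
    rintro f g hf hg
    refine ⟨?_, fun α => ?_⟩
    · rw [zeroExt_add]
      exact hf.holo.add hg.holo
    · obtain ⟨u, hu, hu'⟩ := hf.ext α
      obtain ⟨v, hv, hv'⟩ := hg.ext α
      refine ⟨u + v, hu.add hv, fun z hz => ?_⟩
      rw [zeroExt_add, mderiv_add α (hf.holo z hz) (hg.holo z hz), ← hu' z hz, ← hv' z hz]
      rfl
  smul_mem' := by
    rintro a f hf
    refine ⟨?_, fun α => ?_⟩
    · rw [zeroExt_smul]
      exact fun z hz => analyticAt_const.smul (hf.holo z hz)
    · obtain ⟨u, hu, hu'⟩ := hf.ext α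
      refine ⟨a • u, hu.const_smul a, fun z hz => ?_⟩
      rw [zeroExt_smul, mderiv_smul α a (hf.holo z hz), ← hu' z hz]
      rfl

/-- The space `𝒜^∞(Ω)` of holomorphic functions on `Ω` smooth up to the boundary. It is a type of
its own, so that it does not inherit the topology of pointwise convergence. -/
def AInfty {n : ℕ} (Ω : Set (Fin n → ℂ)) : Type := aInftySubmodule Ω

namespace AInfty

instance {n : ℕ} (Ω : Set (Fin n → ℂ)) : AddCommGroup (AInfty Ω) :=
  inferInstanceAs (AddCommGroup (aInftySubmodule Ω))

instance {n : ℕ} (Ω : Set (Fin n → ℂ)) : Module ℂ (AInfty Ω) :=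
  inferInstanceAs (Module ℂ (aInftySubmodule Ω))

/-- The underlying function on `Ω`. -/
def toFun {n : ℕ} {Ω : Set (Fin n → ℂ)} (f : AInfty Ω) : Ω → ℂ := f.1

instance {n : ℕ} (Ω : Set (Fin n → ℂ)) : CoeFun (AInfty Ω) (fun _ => Ω → ℂ) := ⟨toFun⟩

theorem isAInfty {n : ℕ} {Ω : Set (Fin n → ℂ)} (f : AInfty Ω) : IsAInfty Ω f := f.2

theorem toFun_add {n : ℕ} {Ω : Set (Fin n → ℂ)} (f g : AInfty Ω) :
    (f + g).toFun = f.toFun + g.toFun := rfl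

theorem toFun_smul {n : ℕ} {Ω : Set (Fin n → ℂ)} (a : ℂ) (f : AInfty Ω) :
    (a • f).toFun = a • f.toFun := rfl

end AInfty

/-- The polydisc `P_m = {z : |zⱼ| < m for all j}`. -/
def polydisc (n m : ℕ) : Set (Fin n → ℂ) := {z | ∀ j, ‖z j‖ < m}

/-- The indices of the supremum below: a multi-index of length at most `k` and a point of
`Ω_m = Ω ∩ P_m`. -/
abbrev SupIndex {n : ℕ} (Ω : Set (Fin n → ℂ)) (k m : ℕ) : Type :=
  {α : Fin n → ℕ // ∑ j, α j ≤ k} × ↥(Ω ∩ polydisc n m)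

/-- `‖f‖_{k, Ω_m} = sup {|D^α f(z)| : z ∈ Ω ∩ P_m, α₁ + ⋯ + αₙ ≤ k}`. -/
def ckNorm {n : ℕ} {Ω : Set (Fin n → ℂ)} (k m : ℕ) (f : AInfty Ω) : ℝ :=
  ⨆ p : SupIndex Ω k m, ‖mderiv p.1.1 (zeroExt f.toFun) p.2.1‖

/-- The supremum is taken over a bounded set. -/
theorem bddAbove_ckNorm {n : ℕ} {Ω : Set (Fin n → ℂ)} (k m : ℕ) (f : AInfty Ω) :
    BddAbove (Set.range fun p : SupIndex Ω k m =>
      ‖mderiv p.1.1 (zeroExt f.toFun) p.2.1‖) := by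
  have hfin : Finite {α : Fin n → ℕ // ∑ j, α j ≤ k} := by
    refine Set.Finite.subset (Set.finite_Iic (fun _ : Fin n => k)) ?_
    intro α hα j
    exact (Finset.single_le_sum (f := α) (fun _ _ => Nat.zero_le _) (Finset.mem_univ j)).trans hα
  have hα : ∀ α : {α : Fin n → ℕ // ∑ j, α j ≤ k}, ∃ C : ℝ, ∀ z ∈ Ω ∩ polydisc n m,
      ‖mderiv α.1 (zeroExt f.toFun) z‖ ≤ C := by
    intro α
    obtain ⟨g, hg, hg'⟩ := f.isAInfty.ext α.1
    have hK : IsCompact (closure Ω ∩ Metric.closedBall (0 : Fin n → ℂ) m) :=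
      (isCompact_closedBall _ _).inter_left isClosed_closure
    obtain ⟨C, hC⟩ := hK.exists_bound_of_continuousOn (hg.mono Set.inter_subset_left)
    refine ⟨C, fun z hz => ?_⟩
    rw [← hg' z hz.1]
    refine hC z ⟨subset_closure hz.1, ?_⟩
    rw [mem_closedBall_zero_iff, pi_norm_le_iff_of_nonneg (Nat.cast_nonneg m)]
    exact fun j => (hz.2 j).le
  choose C hC using hα
  obtain ⟨B, hB⟩ := (Set.finite_range C).bddAbove
  refine ⟨B, ?_⟩
  rintro _ ⟨p, rfl⟩
  exact (hC p.1 p.2.1 p.2.2).trans (hB ⟨p.1, rfl⟩)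

/-- `‖·‖_{k, Ω_m}` as a seminorm on `𝒜^∞(Ω)`. -/
def ckSeminorm {n : ℕ} (Ω : Set (Fin n → ℂ)) (k m : ℕ) : Seminorm ℂ (AInfty Ω) :=
  Seminorm.of (ckNorm k m)
    (by
      intro f g
      refine Real.iSup_le (fun p => ?_)
        (add_nonneg (Real.iSup_nonneg fun _ => norm_nonneg _)
          (Real.iSup_nonneg fun _ => norm_nonneg _))
      rw [AInfty.toFun_add, zeroExt_add,
        mderiv_add _ (f.isAInfty.holo _ p.2.2.1) (g.isAInfty.holo _ p.2.2.1)]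
      exact (norm_add_le _ _).trans
        (add_le_add (le_ciSup (bddAbove_ckNorm k m f) p) (le_ciSup (bddAbove_ckNorm k m g) p)))
    (by
      intro a f
      unfold ckNorm
      rw [Real.mul_iSup_of_nonneg (norm_nonneg a)]
      refine iSup_congr fun p => ?_
      rw [AInfty.toFun_smul, zeroExt_smul, mderiv_smul _ a (f.isAInfty.holo _ p.2.2.1), norm_mul])

/-- The family of seminorms `‖·‖_{k, Ω_m}`, `k, m ∈ ℕ`. -/
def ckFamily {n : ℕ} (Ω : Set (Fin n → ℂ)) : SeminormFamily ℂ (AInfty Ω) (ℕ × ℕ) :=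
  fun p => ckSeminorm Ω p.1 p.2

/-- The Fréchet topology of `𝒜^∞(Ω)`: the locally convex topology generated by the seminorms
`‖·‖_{k, Ω_m}`, `k, m ∈ ℕ`. -/
instance {n : ℕ} (Ω : Set (Fin n → ℂ)) : TopologicalSpace (AInfty Ω) :=
  (ckFamily Ω).moduleFilterBasis.topology

theorem withSeminorms_ckFamily {n : ℕ} (Ω : Set (Fin n → ℂ)) : WithSeminorms (ckFamily Ω) :=
  ⟨rfl⟩

/-- A formal series `∑_{a ∈ Γ} x_a` is absolutely convergent: for some bijection `σ : ℕ → Γ`, the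
series `∑ⱼ p(x_{σ(j)})` converges for every continuous seminorm `p`. -/
def AbsolutelyConvergent {Γ X : Type*} [AddCommGroup X] [Module ℂ X] [TopologicalSpace X]
    (x : Γ → X) : Prop :=
  ∃ σ : ℕ ≃ Γ, ∀ p : Seminorm ℂ X, Continuous p → Summable fun j => p (x (σ j))

/-- A formal series `∑_{a ∈ Γ} x_a` converges unconditionally to `s`: for every bijection
`σ : ℕ → Γ`, the partial sums of `∑ⱼ x_{σ(j)}` converge to `s`. -/
def UnconditionallyConvergesTo {Γ X : Type*} [AddCommGroup X] [TopologicalSpace X]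
    (x : Γ → X) (s : X) : Prop :=
  ∀ σ : ℕ ≃ Γ, Tendsto (fun N => ∑ j ∈ Finset.range N, x (σ j)) atTop (𝓝 s)

/-- The Laurent coefficient of `f` of exponent `α`, by the Cauchy formula on the torus
`|ζⱼ| = |wⱼ|` through a point `w`:
`(2πi)⁻ⁿ ∫ f(ζ) ζ^{-α} dζ₁/ζ₁ ⋯ dζₙ/ζₙ`. -/
def laurentCoeff {n : ℕ} {Ω : Set (Fin n → ℂ)} (f : Ω → ℂ) (w : Fin n → ℂ)
    (α : Fin n → ℤ) : ℂ :=
  ((2 * (Real.pi : ℂ) * Complex.I) ^ n)⁻¹ *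
    torusIntegral (fun ζ => zeroExt f ζ / ∏ j, ζ j ^ (α j + 1)) 0 (fun j => ‖w j‖)

end LaurentAInfty

end

noncomputable section

namespace LaurentAInfty
open MeasureTheory UnitAddTorus

/-! ### Partial derivatives of analytic functions -/

/-! The torus acts on `Ω` by rotations, and the Laurent series is the Fourier series along the
orbits. For `g` on `Ω`, let `torusCoeff g α z` be the `α`-th Fourier coefficient of `t ↦ g (rot t
z)`.

It is holomorphic in `z` and transforms under rotations by the character `α`, so it satisfies
Euler's identities `zⱼ ∂ⱼF = αⱼ F` (`euler_torusCoeff`). On a connected open set these force `F = c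
z^α` (`exists_eq_mul_monomial`); evaluation at the point `(|wⱼ|)` identifies `c` with the Cauchy
integral (`torusCoeff_norm_eq`).

Differentiation only shifts the index: `D^β` of the `α`-th coefficient of `f` is the `(α - β)`-th
coefficient of `D^β f` (`mderiv_torusCoeff`). Averaging a continuous extension of `D^β f` over the
torus therefore extends the derivatives of each term to `closure Ω`.

For convergence, `zⱼ ∂ⱼ` multiplies the `α`-th coefficient by `αⱼ`, and all iterates of `zⱼ ∂ⱼ` on
`D^β f` are bounded on `Ω ∩ P_m`. Hence the coefficients of `D^β f` decay faster than any power of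
`‖α‖`, uniformly on `Ω ∩ P_m` (`exists_norm_torusCoeff_le`). This gives a summable majorant for each
seminorm, hence absolute convergence. The sum is `f`, because the Fourier series of `t ↦ D^β f (rot
t z)` can be evaluated at `t = 0`. -/

theorem pderiv_eqOn {n : ℕ} {Ω : Set (Fin n → ℂ)} (hΩ : IsOpen Ω) (j : Fin n)
    {g h : (Fin n → ℂ) → ℂ} (hgh : Set.EqOn g h Ω) : Set.EqOn (pderiv j g) (pderiv j h) Ω :=
  fun _ hz => (pderiv_congr j (hgh.eventuallyEq_of_mem (hΩ.mem_nhds hz))).eq_of_nhds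

theorem pderiv_iterate_eqOn {n : ℕ} {Ω : Set (Fin n → ℂ)} (hΩ : IsOpen Ω) (j : Fin n) (k : ℕ)
    {g h : (Fin n → ℂ) → ℂ} (hgh : Set.EqOn g h Ω) :
    Set.EqOn ((pderiv j)^[k] g) ((pderiv j)^[k] h) Ω := by
  induction k with
  | zero => exact hgh
  | succ k ih =>
    simp only [Function.iterate_succ_apply']
    exact pderiv_eqOn hΩ j ih

theorem mderivList_eqOn {n : ℕ} {Ω : Set (Fin n → ℂ)} (hΩ : IsOpen Ω) (β : Fin n → ℕ)
    (l : List (Fin n)) {g h : (Fin n → ℂ) → ℂ} (hgh : Set.EqOn g h Ω) :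
    Set.EqOn (mderivList β l g) (mderivList β l h) Ω := by
  induction l with
  | nil => exact hgh
  | cons j l ih => exact pderiv_iterate_eqOn hΩ j (β j) ih

theorem analyticOnNhd_pderiv {n : ℕ} {Ω : Set (Fin n → ℂ)} (j : Fin n)
    {g : (Fin n → ℂ) → ℂ} (hg : AnalyticOnNhd ℂ g Ω) : AnalyticOnNhd ℂ (pderiv j g) Ω :=
  fun z hz => analyticAt_pderiv j (hg z hz)

theorem analyticOnNhd_mderiv {n : ℕ} {Ω : Set (Fin n → ℂ)} (β : Fin n → ℕ)
    {g : (Fin n → ℂ) → ℂ} (hg : AnalyticOnNhd ℂ g Ω) : AnalyticOnNhd ℂ (mderiv β g) Ω :=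
  fun z hz => analyticAt_mderiv β (hg z hz)

theorem pderiv_comm {n : ℕ} (i j : Fin n) {g : (Fin n → ℂ) → ℂ} {z : Fin n → ℂ}
    (hg : AnalyticAt ℂ g z) : pderiv i (pderiv j g) z = pderiv j (pderiv i g) z := by
  have hd : DifferentiableAt ℂ (fderiv ℂ g) z := hg.fderiv.differentiableAt
  have key : ∀ i j : Fin n, pderiv i (pderiv j g) z =
      fderiv ℂ (fderiv ℂ g) z (Pi.single i 1) (Pi.single j 1) := by
    intro i j
    have : HasFDerivAt (pderiv j g)
        ((ContinuousLinearMap.apply ℂ ℂ (Pi.single j 1 : Fin n → ℂ)).comp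
          (fderiv ℂ (fderiv ℂ g) z)) z :=
      (ContinuousLinearMap.apply ℂ ℂ (Pi.single j 1 : Fin n → ℂ)).hasFDerivAt.comp z hd.hasFDerivAt
    rw [pderiv, this.fderiv]
    rfl
  rw [key, key]
  exact (hg.contDiffAt (n := ⊤)).isSymmSndFDerivAt (by simp) _ _

theorem pderiv_iterate_comm {n : ℕ} {Ω : Set (Fin n → ℂ)} (hΩ : IsOpen Ω) (i j : Fin n) (k : ℕ)
    {g : (Fin n → ℂ) → ℂ} (hg : AnalyticOnNhd ℂ g Ω) :
    Set.EqOn (pderiv i ((pderiv j)^[k] g)) ((pderiv j)^[k] (pderiv i g)) Ω := by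
  induction k with
  | zero => exact fun _ _ => rfl
  | succ k ih =>
    simp only [Function.iterate_succ_apply']
    exact Set.EqOn.trans
      (fun z hz => pderiv_comm i j (analyticAt_pderiv_iterate j k (hg z hz)))
      (pderiv_eqOn hΩ j ih)

theorem mderivList_add_single_of_notMem {n : ℕ} (β : Fin n → ℕ) (i : Fin n) {l : List (Fin n)}
    (hi : i ∉ l) (g : (Fin n → ℂ) → ℂ) :
    mderivList (β + Pi.single i 1) l g = mderivList β l g := by
  induction l with
  | nil => rfl
  | cons j l ih =>
    have hji : j ≠ i := fun h => hi (h ▸ List.mem_cons_self)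
    have := ih (fun h => hi (List.mem_cons_of_mem _ h))
    simp only [mderivList, List.foldr_cons] at this ⊢
    rw [this]
    simp [hji]

/-- `mderivList` differentiates in a fixed order, so the extra `∂ᵢ` is commuted inward to its own
block. As `l` has no repetition, raising `βᵢ` lengthens only that block. -/
theorem pderiv_mderivList {n : ℕ} {Ω : Set (Fin n → ℂ)} (hΩ : IsOpen Ω)
    (β : Fin n → ℕ) (i : Fin n) {l : List (Fin n)} (hl : l.Nodup) (hi : i ∈ l)
    {g : (Fin n → ℂ) → ℂ} (hg : AnalyticOnNhd ℂ g Ω) :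
    Set.EqOn (pderiv i (mderivList β l g)) (mderivList (β + Pi.single i 1) l g) Ω := by
  induction l with
  | nil => simp at hi
  | cons j l ih =>
    rw [List.nodup_cons] at hl
    by_cases hij : i = j
    · subst hij
      have h := mderivList_add_single_of_notMem β i hl.1 g
      intro z _
      simp only [mderivList, List.foldr_cons] at h ⊢
      rw [h]
      simp [Function.iterate_succ_apply']
    · have hi' : i ∈ l := by simpa [hij] using hi
      have h := ih hl.2 hi'
      have hb : (β + (Pi.single i 1 : Fin n → ℕ)) j = β j := by simp [Ne.symm hij]
      have hc : mderivList (β + Pi.single i 1) (j :: l) g =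
          (pderiv j)^[β j] (mderivList (β + Pi.single i 1) l g) := by
        rw [← hb]
        rfl
      rw [hc]
      exact (pderiv_iterate_comm hΩ i j (β j)
        (fun z hz => analyticAt_mderivList β l (hg z hz))).trans
        (pderiv_iterate_eqOn hΩ j (β j) h)

theorem pderiv_mderiv {n : ℕ} {Ω : Set (Fin n → ℂ)} (hΩ : IsOpen Ω)
    (β : Fin n → ℕ) (i : Fin n) {g : (Fin n → ℂ) → ℂ} (hg : AnalyticOnNhd ℂ g Ω) :
    Set.EqOn (pderiv i (mderiv β g)) (mderiv (β + Pi.single i 1) g) Ω :=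
  pderiv_mderivList hΩ β i (List.nodup_finRange n) (List.mem_finRange i) hg

theorem mderiv_eqOn {n : ℕ} {Ω : Set (Fin n → ℂ)} (hΩ : IsOpen Ω) (β : Fin n → ℕ)
    {g h : (Fin n → ℂ) → ℂ} (hgh : Set.EqOn g h Ω) :
    Set.EqOn (mderiv β g) (mderiv β h) Ω :=
  mderivList_eqOn hΩ β _ hgh

theorem zeroExt_eqOn {n : ℕ} {Ω : Set (Fin n → ℂ)} (g : (Fin n → ℂ) → ℂ) :
    Set.EqOn (zeroExt fun z : Ω => g z) g Ω :=
  fun z hz => zeroExt_apply (fun z : Ω => g z) ⟨z, hz⟩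

/-! ### Averages over the torus -/

attribute [local instance] instMeasureSpaceUnitAddCircle
attribute [local instance] instIsAddHaarMeasureUnitAddCircleVolume
attribute [local instance] instIsProbabilityMeasureUnitAddCircleVolume

/-- The action of the torus on `ℂⁿ` by rotations of the coordinates. -/
def rot {n : ℕ} (t : UnitAddTorus (Fin n)) (z : Fin n → ℂ) : Fin n → ℂ :=
  fun j => fourier 1 (t j) * z j

/-- The Fourier coefficient of exponent `α` of `t ↦ g (t • z)`. -/
def torusCoeff {n : ℕ} (g : (Fin n → ℂ) → ℂ) (α : Fin n → ℤ) (z : Fin n → ℂ) : ℂ :=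
  mFourierCoeff (fun t => g (rot t z)) α

theorem torusCoeff_eq {n : ℕ} (g : (Fin n → ℂ) → ℂ) (α : Fin n → ℤ) (z : Fin n → ℂ) :
    torusCoeff g α z = ∫ t : UnitAddTorus (Fin n), mFourier (-α) t * g (rot t z) := rfl

theorem norm_fourier_one (t : UnitAddCircle) : ‖(fourier 1 t : ℂ)‖ = 1 := by
  rw [fourier_apply]
  exact Circle.norm_coe _

theorem continuous_rot {n : ℕ} :
    Continuous fun p : (Fin n → ℂ) × UnitAddTorus (Fin n) => rot p.2 p.1 := by
  unfold rot
  fun_prop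

theorem rot_zero {n : ℕ} (z : Fin n → ℂ) : rot 0 z = z := by
  ext j
  simp [rot]

theorem rot_add {n : ℕ} (s t : UnitAddTorus (Fin n)) (z : Fin n → ℂ) :
    rot (s + t) z = rot s (rot t z) := by
  ext j
  simp only [rot, Pi.add_apply, fourier_apply, one_smul, AddCircle.toCircle_add, Circle.coe_mul]
  ring

theorem IsReinhardtDomain.rot_mem {n : ℕ} {Ω : Set (Fin n → ℂ)} (hΩ : IsReinhardtDomain Ω)
    (t : UnitAddTorus (Fin n)) : Set.MapsTo (rot t) Ω Ω :=
  fun z hz => hΩ.rotate_mem z hz _ fun j => norm_fourier_one (t j)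

theorem IsReinhardtDomain.rot_mem_inter {n : ℕ} {Ω : Set (Fin n → ℂ)} (hΩ : IsReinhardtDomain Ω)
    (t : UnitAddTorus (Fin n)) (m : ℕ) :
    Set.MapsTo (rot t) (Ω ∩ polydisc n m) (Ω ∩ polydisc n m) := by
  refine fun z hz => ⟨hΩ.rot_mem t hz.1, fun j => ?_⟩
  rw [rot, norm_mul, norm_fourier_one, one_mul]
  exact hz.2 j

theorem IsReinhardtDomain.rot_mem_closure {n : ℕ} {Ω : Set (Fin n → ℂ)}
    (hΩ : IsReinhardtDomain Ω) (t : UnitAddTorus (Fin n)) :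
    Set.MapsTo (rot t) (closure Ω) (closure Ω) :=
  (hΩ.rot_mem t).closure (continuous_rot.comp (Continuous.prodMk_left t))

/-- Only continuity and rotation invariance are asked for, so that `S` can be `closure Ω` and `g` a
continuous extension of a derivative. -/
theorem continuousOn_torusCoeff {n : ℕ} {S : Set (Fin n → ℂ)}
    (hS : ∀ t, Set.MapsTo (rot t) S S) {g : (Fin n → ℂ) → ℂ} (hg : ContinuousOn g S)
    (α : Fin n → ℤ) : ContinuousOn (torusCoeff g α) S := by
  refine continuousOn_integral_of_compact_support (k := Set.univ) isCompact_univ ?_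
    (fun p t _ ht => (ht (Set.mem_univ t)).elim)
  refine ContinuousOn.smul ((mFourier (-α)).continuous.comp continuous_snd).continuousOn ?_
  exact hg.comp continuous_rot.continuousOn fun p hp => hS p.2 hp.1

theorem norm_mFourier_apply {n : ℕ} (α : Fin n → ℤ) (t : UnitAddTorus (Fin n)) :
    ‖mFourier α t‖ = 1 := by
  simp only [mFourier, ContinuousMap.coe_mk, fourier_apply, norm_prod]
  exact Finset.prod_eq_one fun j _ => Circle.norm_coe _

theorem norm_torusCoeff_le {n : ℕ} {g : (Fin n → ℂ) → ℂ} {z : Fin n → ℂ} {C : ℝ}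
    (hC : ∀ t, ‖g (rot t z)‖ ≤ C) (α : Fin n → ℤ) : ‖torusCoeff g α z‖ ≤ C := by
  have h := norm_integral_le_of_norm_le_const (μ := (volume : Measure (UnitAddTorus (Fin n))))
    (f := fun t => mFourier (-α) t * g (rot t z)) (C := C)
    (Eventually.of_forall fun t => by rw [norm_mul, norm_mFourier_apply, one_mul]; exact hC t)
  rw [torusCoeff_eq]
  simpa using h

theorem torusCoeff_congr {n : ℕ} {g h : (Fin n → ℂ) → ℂ} {z : Fin n → ℂ}
    (hgh : ∀ t, g (rot t z) = h (rot t z)) (α : Fin n → ℤ) :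
    torusCoeff g α z = torusCoeff h α z := by
  simp only [torusCoeff, hgh]

/-- Translation invariance of Haar measure: replacing `t + s` by `t` brings out the character at
`s`. -/
theorem torusCoeff_rot {n : ℕ} (g : (Fin n → ℂ) → ℂ) (α : Fin n → ℤ) (z : Fin n → ℂ)
    (s : UnitAddTorus (Fin n)) :
    torusCoeff g α (rot s z) = mFourier α s * torusCoeff g α z := by
  have h : ∀ t, mFourier (-α) t * g (rot t (rot s z)) =
      mFourier α s * (mFourier (-α) (t + s) * g (rot (t + s) z)) := by
    intro t
    have hm : mFourier (-α) (t + s) = mFourier (-α) t * mFourier (-α) s := by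
      simp only [mFourier, ContinuousMap.coe_mk, Pi.add_apply, ← Finset.prod_mul_distrib]
      refine Finset.prod_congr rfl fun j _ => ?_
      simp [fourier_apply, AddCircle.toCircle_add]
    have h1 : mFourier α s * mFourier (-α) s = 1 := by
      rw [← mFourier_add, add_neg_cancel, mFourier_zero]
      rfl
    rw [← rot_add, hm]
    linear_combination (-mFourier (-α) t * g (rot (t + s) z)) * h1
  rw [torusCoeff_eq, torusCoeff_eq]
  simp_rw [h]
  rw [integral_const_mul]
  congr 1
  exact integral_add_right_eq_self (fun t => mFourier (-α) t * g (rot t z)) s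

theorem mFourier_neg_mul_fourier_one {n : ℕ} (α : Fin n → ℤ) (j : Fin n)
    (t : UnitAddTorus (Fin n)) :
    mFourier (-α) t * fourier 1 (t j) = mFourier (-(α - Pi.single j 1)) t := by
  rw [← mFourier_single, ← mFourier_add]
  congr 2
  abel

/-- The rotation `rot t` as a continuous linear map. -/
def rotL {n : ℕ} (t : UnitAddTorus (Fin n)) : (Fin n → ℂ) →L[ℂ] (Fin n → ℂ) :=
  ContinuousLinearMap.pi fun j => (fourier 1 (t j) : ℂ) • ContinuousLinearMap.proj j

theorem rotL_apply {n : ℕ} (t : UnitAddTorus (Fin n)) (z : Fin n → ℂ) : rotL t z = rot t z := by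
  ext j
  simp [rotL, rot]

theorem continuous_rotL {n : ℕ} : Continuous (rotL (n := n)) := by
  rw [continuous_clm_apply]
  intro z
  simp_rw [rotL_apply]
  exact continuous_rot.comp (Continuous.prodMk_right z)

/-- Differentiation under the integral sign over a compact space. -/
theorem hasFDerivAt_integral_of_compactSpace {E X : Type*} [NormedAddCommGroup E]
    [NormedSpace ℂ E] [ProperSpace E] [TopologicalSpace X] [CompactSpace X] [MeasurableSpace X]
    [OpensMeasurableSpace X] {μ : Measure X} [IsFiniteMeasure μ] {Ω : Set E} (hΩ : IsOpen Ω)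
    {F : E → X → ℂ} {F' : E → X → E →L[ℂ] ℂ}
    (hF : ContinuousOn (Function.uncurry F) (Ω ×ˢ Set.univ))
    (hF' : ContinuousOn (Function.uncurry F') (Ω ×ˢ Set.univ))
    (hd : ∀ x ∈ Ω, ∀ t, HasFDerivAt (fun y => F y t) (F' x t) x) {z : E} (hz : z ∈ Ω) :
    Integrable (F' z) μ ∧ HasFDerivAt (fun x => ∫ t, F x t ∂μ) (∫ t, F' z t ∂μ) z := by
  obtain ⟨r, hr, hball⟩ := Metric.nhds_basis_closedBall.mem_iff.1 (hΩ.mem_nhds hz)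
  have hslice : ∀ x ∈ Ω, Continuous (F x) := fun x hx =>
    continuousOn_univ.1 (hF.comp (Continuous.prodMk_right x).continuousOn
      fun t _ => ⟨hx, Set.mem_univ t⟩)
  have hslice' : Continuous (F' z) :=
    continuousOn_univ.1 (hF'.comp (Continuous.prodMk_right z).continuousOn
      fun t _ => ⟨hz, Set.mem_univ t⟩)
  -- Compactness of the closed ball times `X` makes a constant serve as the dominating function.
  obtain ⟨C, hC⟩ := ((isCompact_closedBall z r).prod
    (isCompact_univ (X := X))).exists_bound_of_continuousOn
    (hF'.mono (Set.prod_mono hball subset_rfl))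
  have hint : Integrable (F' z) μ :=
    hslice'.integrable_of_hasCompactSupport (HasCompactSupport.of_compactSpace _)
  refine ⟨hint, hasFDerivAt_integral_of_dominated_of_fderiv_le (bound := fun _ => C)
    (Metric.closedBall_mem_nhds z hr) ?_ ?_ hint.aestronglyMeasurable ?_ (integrable_const C) ?_⟩
  · filter_upwards [hΩ.mem_nhds hz] with x hx
    exact ((hslice x hx).integrable_of_hasCompactSupport
      (HasCompactSupport.of_compactSpace _)).aestronglyMeasurable
  · exact (hslice z hz).integrable_of_hasCompactSupport (HasCompactSupport.of_compactSpace _)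
  · exact Eventually.of_forall fun t x hx => hC (x, t) ⟨hx, Set.mem_univ t⟩
  · exact Eventually.of_forall fun t x hx => hd x (hball hx) t

/-! ### Derivatives of the Fourier coefficients and Euler's identities -/

theorem hasFDerivAt_torusCoeff {n : ℕ} {Ω : Set (Fin n → ℂ)} (hΩ : IsOpen Ω)
    (hrot : ∀ t, Set.MapsTo (rot t) Ω Ω) {g : (Fin n → ℂ) → ℂ} (hg : AnalyticOnNhd ℂ g Ω)
    (α : Fin n → ℤ) {z : Fin n → ℂ} (hz : z ∈ Ω) :
    Integrable (fun t => mFourier (-α) t • (fderiv ℂ g (rot t z)).comp (rotL t)) volume ∧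
    HasFDerivAt (torusCoeff g α)
      (∫ t, mFourier (-α) t • (fderiv ℂ g (rot t z)).comp (rotL t)) z := by
  have hm : Continuous fun p : (Fin n → ℂ) × UnitAddTorus (Fin n) => mFourier (-α) p.2 :=
    (mFourier (-α)).continuous.comp continuous_snd
  have hF : ContinuousOn (fun p : (Fin n → ℂ) × UnitAddTorus (Fin n) => g (rot p.2 p.1))
      (Ω ×ˢ Set.univ) :=
    hg.continuousOn.comp continuous_rot.continuousOn fun p hp => hrot p.2 hp.1
  have hF' : ContinuousOn (fun p : (Fin n → ℂ) × UnitAddTorus (Fin n) =>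
      (fderiv ℂ g (rot p.2 p.1)).comp (rotL p.2)) (Ω ×ˢ Set.univ) :=
    ContinuousOn.clm_comp
      (hg.fderiv.continuousOn.comp continuous_rot.continuousOn fun p hp => hrot p.2 hp.1)
      (continuous_rotL.comp continuous_snd).continuousOn
  have hd : ∀ x ∈ Ω, ∀ t, HasFDerivAt (fun y => mFourier (-α) t * g (rot t y))
      (mFourier (-α) t • (fderiv ℂ g (rot t x)).comp (rotL t)) x := by
    intro x hx t
    have h1 : HasFDerivAt (rot t) (rotL t) x := by
      have := (rotL t).hasFDerivAt (x := x)
      rwa [show ⇑(rotL t) = rot t from funext (rotL_apply t)] at this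
    exact ((hg _ (hrot t hx)).differentiableAt.hasFDerivAt.comp x h1).const_mul _
  exact hasFDerivAt_integral_of_compactSpace (F := fun x t => mFourier (-α) t * g (rot t x))
    (F' := fun x t => mFourier (-α) t • (fderiv ℂ g (rot t x)).comp (rotL t))
    hΩ (hm.continuousOn.mul hF) (hm.continuousOn.smul hF') hd hz

/-- By the chain rule, differentiating `g (rot t z)` in `zⱼ` yields the factor `fourier 1 (t j)`,
which the character absorbs as the shift of `α`. -/
theorem pderiv_torusCoeff {n : ℕ} {Ω : Set (Fin n → ℂ)} (hΩ : IsOpen Ω)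
    (hrot : ∀ t, Set.MapsTo (rot t) Ω Ω) {g : (Fin n → ℂ) → ℂ} (hg : AnalyticOnNhd ℂ g Ω)
    (α : Fin n → ℤ) (j : Fin n) :
    Set.EqOn (pderiv j (torusCoeff g α)) (torusCoeff (pderiv j g) (α - Pi.single j 1)) Ω := by
  intro z hz
  obtain ⟨hi, hd⟩ := hasFDerivAt_torusCoeff hΩ hrot hg α hz
  rw [pderiv, hd.fderiv, ContinuousLinearMap.integral_apply hi, torusCoeff_eq]
  refine integral_congr_ae (Eventually.of_forall fun t => ?_)
  have h : rot t (Pi.single j 1) = (fourier 1 (t j) : ℂ) • (Pi.single j 1 : Fin n → ℂ) := by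
    ext i
    by_cases hij : i = j
    · subst hij; simp [rot]
    · simp [rot, hij]
  simp only [smul_apply, ContinuousLinearMap.comp_apply, rotL_apply, h,
    map_smul, smul_eq_mul, pderiv, ← mFourier_neg_mul_fourier_one]
  ring

theorem differentiableOn_torusCoeff {n : ℕ} {Ω : Set (Fin n → ℂ)} (hΩ : IsOpen Ω)
    (hrot : ∀ t, Set.MapsTo (rot t) Ω Ω) {g : (Fin n → ℂ) → ℂ} (hg : AnalyticOnNhd ℂ g Ω)
    (α : Fin n → ℤ) : DifferentiableOn ℂ (torusCoeff g α) Ω :=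
  fun _ hz => (hasFDerivAt_torusCoeff hΩ hrot hg α hz).2.differentiableAt.differentiableWithinAt

theorem pderiv_iterate_torusCoeff {n : ℕ} {Ω : Set (Fin n → ℂ)} (hΩ : IsOpen Ω)
    (hrot : ∀ t, Set.MapsTo (rot t) Ω Ω) {g : (Fin n → ℂ) → ℂ} (hg : AnalyticOnNhd ℂ g Ω)
    (α : Fin n → ℤ) (j : Fin n) (k : ℕ) :
    Set.EqOn ((pderiv j)^[k] (torusCoeff g α))
      (torusCoeff ((pderiv j)^[k] g) (α - Pi.single j (k : ℤ))) Ω := by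
  induction k with
  | zero => simp [Set.eqOn_refl]
  | succ k ih =>
    simp only [Function.iterate_succ_apply']
    refine (pderiv_eqOn hΩ j ih).trans ?_
    have h := pderiv_torusCoeff hΩ hrot (fun z hz => analyticAt_pderiv_iterate j k (hg z hz))
      (α - Pi.single j (k : ℤ)) j
    rwa [sub_sub, ← Pi.single_add, ← Nat.cast_succ] at h

theorem mderivList_torusCoeff {n : ℕ} {Ω : Set (Fin n → ℂ)} (hΩ : IsOpen Ω)
    (hrot : ∀ t, Set.MapsTo (rot t) Ω Ω) {g : (Fin n → ℂ) → ℂ} (hg : AnalyticOnNhd ℂ g Ω)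
    (α : Fin n → ℤ) (β : Fin n → ℕ) (l : List (Fin n)) :
    Set.EqOn (mderivList β l (torusCoeff g α))
      (torusCoeff (mderivList β l g)
        (α - (l.map fun j => (Pi.single j (β j : ℤ) : Fin n → ℤ)).sum)) Ω := by
  induction l with
  | nil => simp [Set.eqOn_refl, mderivList]
  | cons j l ih =>
    refine (pderiv_iterate_eqOn hΩ j (β j) ih).trans ?_
    have h := pderiv_iterate_torusCoeff hΩ hrot
      (fun z hz => analyticAt_mderivList β l (hg z hz))
      (α - (l.map fun j => (Pi.single j (β j : ℤ) : Fin n → ℤ)).sum) j (β j)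
    rw [List.map_cons, List.sum_cons, add_comm, ← sub_sub]
    exact h

theorem mderiv_torusCoeff {n : ℕ} {Ω : Set (Fin n → ℂ)} (hΩ : IsOpen Ω)
    (hrot : ∀ t, Set.MapsTo (rot t) Ω Ω) {g : (Fin n → ℂ) → ℂ} (hg : AnalyticOnNhd ℂ g Ω)
    (α : Fin n → ℤ) (β : Fin n → ℕ) :
    Set.EqOn (mderiv β (torusCoeff g α))
      (torusCoeff (mderiv β g) (α - fun j => (β j : ℤ))) Ω := by
  have h := mderivList_torusCoeff hΩ hrot hg α β (List.finRange n)
  rwa [← List.ofFn_eq_map, List.sum_ofFn,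
    Finset.univ_sum_single (fun j => (β j : ℤ))] at h

/-- Euler's identity for the homogeneous components of a function. -/
theorem euler_torusCoeff {n : ℕ} {Ω : Set (Fin n → ℂ)} (hΩ : IsOpen Ω)
    (hrot : ∀ t, Set.MapsTo (rot t) Ω Ω) {g : (Fin n → ℂ) → ℂ} (hg : AnalyticOnNhd ℂ g Ω)
    (α : Fin n → ℤ) (j : Fin n) {z : Fin n → ℂ} (hz : z ∈ Ω) :
    z j * pderiv j (torusCoeff g α) z = α j * torusCoeff g α z := by
  have hd := (hasFDerivAt_torusCoeff hΩ hrot hg α hz).2.differentiableAt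
  have hexp : ∀ a : ℂ, HasDerivAt (fun θ : ℝ => Complex.exp (a * θ)) a 0 := by
    intro a
    have := ((hasDerivAt_id (0 : ℝ)).ofReal_comp.const_mul a).cexp
    simpa using this
  -- The derivative of the coefficient along this rotation of the `j`-th coordinate is computed
  -- twice: by the chain rule (`h1`) and by covariance (`h2`).
  let u : ℝ → Fin n → ℂ := fun θ => rot (Pi.single j (θ : UnitAddCircle)) z
  have hu0 : u 0 = z := by simp [u, rot_zero]
  have hu : HasDerivAt u (Pi.single j (2 * Real.pi * Complex.I * z j)) 0 := by
    rw [hasDerivAt_pi]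
    intro i
    by_cases hij : i = j
    · subst hij
      have h := (hexp (2 * Real.pi * Complex.I)).mul_const (z i)
      have hui : (fun θ => u θ i) =
          fun θ : ℝ => Complex.exp (2 * Real.pi * Complex.I * θ) * z i := by
        ext θ
        simp only [u, rot, Pi.single_eq_same, fourier_coe_apply]
        simp
      rwa [hui, Pi.single_eq_same]
    · simpa [u, rot, hij] using hasDerivAt_const (0 : ℝ) (z i)
  have h1 : HasDerivAt (fun θ => torusCoeff g α (u θ))
      (fderiv ℂ (torusCoeff g α) z (Pi.single j (2 * Real.pi * Complex.I * z j))) 0 := by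
    have hd' : HasFDerivAt (torusCoeff g α)
        ((fderiv ℂ (torusCoeff g α) z).restrictScalars ℝ) (u 0) := by
      rw [hu0]
      exact hd.hasFDerivAt.restrictScalars ℝ
    exact hd'.comp_hasDerivAt 0 hu
  have h2 : HasDerivAt (fun θ => torusCoeff g α (u θ))
      (2 * Real.pi * Complex.I * α j * torusCoeff g α z) 0 := by
    have h := (hexp (2 * Real.pi * Complex.I * α j)).mul_const (torusCoeff g α z)
    refine h.congr_of_eventuallyEq (Eventually.of_forall fun θ => ?_)
    simp only [u]
    rw [torusCoeff_rot]
    congr 1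
    simp only [mFourier, ContinuousMap.coe_mk]
    rw [Finset.prod_eq_single j]
    · simp
    · intro i _ hij
      simp [hij]
    · simp
  have h3 := h1.unique h2
  have hs : (Pi.single j (2 * Real.pi * Complex.I * z j) : Fin n → ℂ) =
      (2 * Real.pi * Complex.I * z j) • (Pi.single j 1 : Fin n → ℂ) := by
    rw [← Pi.single_smul, smul_eq_mul, mul_one]
  rw [hs, map_smul, smul_eq_mul] at h3
  have hpi : (2 * Real.pi * Complex.I : ℂ) ≠ 0 := Complex.two_pi_I_ne_zero
  apply mul_left_cancel₀ hpi
  rw [pderiv]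
  linear_combination h3

/-! ### Monomials and functions that satisfy Euler's identities -/

/-- The Laurent monomial `z ^ α`. -/
def monomial {n : ℕ} (α : Fin n → ℤ) (z : Fin n → ℂ) : ℂ := ∏ j, z j ^ α j

/-- The points of `ℂⁿ` none of whose coordinates vanishes. -/
def nonzeroCoords (n : ℕ) : Set (Fin n → ℂ) := {z | ∀ j, z j ≠ 0}

theorem nonzeroCoords_eq_pi (n : ℕ) :
    nonzeroCoords n = Set.univ.pi fun _ : Fin n => ({0}ᶜ : Set ℂ) := by
  ext z
  simp [nonzeroCoords]

theorem dense_nonzeroCoords (n : ℕ) : Dense (nonzeroCoords n) := by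
  rw [nonzeroCoords_eq_pi]
  exact dense_pi _ fun j _ => dense_compl_singleton 0

theorem isOpen_nonzeroCoords (n : ℕ) : IsOpen (nonzeroCoords n) := by
  rw [nonzeroCoords_eq_pi]
  exact isOpen_set_pi Set.finite_univ fun j _ => isOpen_compl_singleton

theorem monomial_ne_zero {n : ℕ} (α : Fin n → ℤ) {z : Fin n → ℂ} (hz : z ∈ nonzeroCoords n) :
    monomial α z ≠ 0 :=
  Finset.prod_ne_zero_iff.2 fun j _ => zpow_ne_zero _ (hz j)

theorem analyticAt_monomial {n : ℕ} {α : Fin n → ℤ} {z : Fin n → ℂ}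
    (hz : ∀ j, z j ≠ 0 ∨ 0 ≤ α j) : AnalyticAt ℂ (monomial α) z := by
  refine Finset.analyticAt_fun_prod _ fun j _ => ?_
  have hj : AnalyticAt ℂ (fun w : Fin n → ℂ => w j) z :=
    (ContinuousLinearMap.proj (R := ℂ) (φ := fun _ : Fin n => ℂ) j).analyticAt z
  rcases hz j with h | h
  · exact hj.zpow h
  · exact hj.zpow_nonneg h

theorem euler_monomial {n : ℕ} (α : Fin n → ℤ) (j : Fin n) {z : Fin n → ℂ}
    (hz : z ∈ nonzeroCoords n) :
    z j * pderiv j (monomial α) z = α j * monomial α z := by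
  have hd := (analyticAt_monomial (α := α) fun j => Or.inl (hz j)).differentiableAt
  have h1 : HasDerivAt (fun s => monomial α (Function.update z j s)) (pderiv j (monomial α) z)
      (z j) := by
    have hd' : HasFDerivAt (monomial α) (fderiv ℂ (monomial α) z) (Function.update z j (z j)) := by
      rw [Function.update_eq_self]
      exact hd.hasFDerivAt
    exact hd'.comp_hasDerivAt (z j) (hasDerivAt_update z j (z j))
  have hM : ∀ s, monomial α (Function.update z j s) =
      s ^ α j * ∏ i ∈ Finset.univ.erase j, z i ^ α i := by
    intro s
    rw [monomial, ← Finset.mul_prod_erase _ _ (Finset.mem_univ j), Function.update_self]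
    congr 1
    refine Finset.prod_congr rfl fun i hi => ?_
    rw [Function.update_of_ne (Finset.ne_of_mem_erase hi)]
  have h2 : HasDerivAt (fun s => monomial α (Function.update z j s))
      (α j * z j ^ (α j - 1) * ∏ i ∈ Finset.univ.erase j, z i ^ α i) (z j) := by
    simp_rw [hM]
    exact (hasDerivAt_zpow (α j) (z j) (Or.inl (hz j))).mul_const _
  rw [h1.unique h2]
  have h3 := hM (z j)
  rw [Function.update_eq_self] at h3
  rw [h3, zpow_sub_one₀ (hz j)]
  field_simp [hz j]

/-- A punctured disc about `0` is the image of a half-plane under `exp`; a small disc about any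
other point misses `0`. -/
theorem exists_isOpen_isPreconnected_diff_zero (a : ℂ) {r : ℝ} (hr : 0 < r) :
    ∃ V : Set ℂ, IsOpen V ∧ a ∈ V ∧ V ⊆ Metric.ball a r ∧ IsPreconnected (V \ {0}) := by
  by_cases ha : a = 0
  · subst ha
    refine ⟨Metric.ball 0 r, Metric.isOpen_ball, Metric.mem_ball_self hr, subset_rfl, ?_⟩
    have hconv : Convex ℝ {w : ℂ | w.re < Real.log r} := convex_halfSpace_re_lt _
    have himg : Complex.exp '' {w : ℂ | w.re < Real.log r} = Metric.ball 0 r \ {0} := by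
      ext w
      simp only [Set.mem_image, Set.mem_ofPred_eq, Set.mem_sdiff, mem_ball_zero_iff,
        Set.mem_singleton_iff]
      constructor
      · rintro ⟨u, hu, rfl⟩
        rw [Complex.norm_exp]
        exact ⟨(Real.lt_log_iff_exp_lt hr).1 hu, Complex.exp_ne_zero u⟩
      · rintro ⟨hw, hw0⟩
        refine ⟨Complex.log w, ?_, Complex.exp_log hw0⟩
        rw [Complex.log_re]
        exact Real.log_lt_log (norm_pos_iff.2 hw0) hw
    rw [← himg]
    exact hconv.isPreconnected.image _ Complex.continuous_exp.continuousOn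
  · have hpos : 0 < min r ‖a‖ := lt_min hr (norm_pos_iff.2 ha)
    refine ⟨Metric.ball a (min r ‖a‖), Metric.isOpen_ball, Metric.mem_ball_self hpos,
      Metric.ball_subset_ball (min_le_left _ _), ?_⟩
    have h0 : (0 : ℂ) ∉ Metric.ball a (min r ‖a‖) := by
      rw [Metric.mem_ball, dist_zero_left, not_lt]
      exact min_le_right _ _
    rw [Set.sdiff_singleton_eq_self h0]
    exact (convex_ball _ _).isPreconnected

theorem exists_isOpen_isPreconnected_inter_nonzeroCoords {n : ℕ} {Ω : Set (Fin n → ℂ)}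
    (hΩ : IsOpen Ω) {p : Fin n → ℂ} (hp : p ∈ Ω) :
    ∃ V ⊆ Ω, IsOpen V ∧ p ∈ V ∧ IsPreconnected (V ∩ nonzeroCoords n) := by
  obtain ⟨r, hr, hball⟩ := Metric.isOpen_iff.1 hΩ p hp
  choose V hVo hpV hVb hVc using fun j => exists_isOpen_isPreconnected_diff_zero (p j) hr
  refine ⟨Set.univ.pi V, fun z hz => hball ?_, isOpen_set_pi Set.finite_univ fun j _ => hVo j,
    fun j _ => hpV j, ?_⟩
  · rw [Metric.mem_ball, dist_pi_lt_iff hr]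
    exact fun j => hVb j (hz j (Set.mem_univ j))
  · rw [nonzeroCoords_eq_pi, ← Set.pi_inter_distrib]
    exact isPreconnected_univ_pi hVc

/-- Euler's identities for `F` and for `z^(-α)` cancel in the product rule, so `F z^(-α)` has zero
derivative. -/
theorem exists_eq_mul_monomial_of_isPreconnected {n : ℕ} {U : Set (Fin n → ℂ)} (hU : IsOpen U)
    (hUc : IsPreconnected U) (hU0 : U ⊆ nonzeroCoords n) {F : (Fin n → ℂ) → ℂ}
    (hF : DifferentiableOn ℂ F U) {α : Fin n → ℤ}
    (hE : ∀ z ∈ U, ∀ j, z j * pderiv j F z = α j * F z) :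
    ∃ c, ∀ z ∈ U, F z = c * monomial α z := by
  have hM : ∀ z ∈ U, DifferentiableAt ℂ (monomial (-α)) z := fun z hz =>
    (analyticAt_monomial fun j => Or.inl (hU0 hz j)).differentiableAt
  obtain ⟨c, hc⟩ := hU.exists_is_const_of_fderiv_eq_zero (𝕜 := ℂ) hUc
    (f := fun z => F z * monomial (-α) z)
    (fun z hz => ((hF z hz).mul (hM z hz).differentiableWithinAt)) (by
      intro z hz
      have hFz := (hF z hz).differentiableAt (hU.mem_nhds hz)
      rw [fderiv_fun_mul hFz (hM z hz)]
      refine ContinuousLinearMap.coe_injective (LinearMap.pi_ext' fun j => LinearMap.ext_ring ?_)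
      have h1 := hE z hz j
      have h2 := euler_monomial (-α) j (hU0 hz)
      simp only [pderiv, Pi.neg_apply, Int.cast_neg] at h1 h2
      apply mul_left_cancel₀ (hU0 hz j)
      change z j * (F z * fderiv ℂ (monomial (-α)) z (Pi.single j 1) +
        monomial (-α) z * fderiv ℂ F z (Pi.single j 1)) = z j * 0
      linear_combination F z * h2 + monomial (-α) z * h1)
  refine ⟨c, fun z hz => ?_⟩
  have h1 : monomial (-α) z * monomial α z = 1 := by
    rw [monomial, monomial, ← Finset.prod_mul_distrib]
    refine Finset.prod_eq_one fun j _ => ?_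
    rw [← zpow_add₀ (hU0 hz j)]
    simp
  rw [← hc z hz]
  linear_combination (-F z) * h1

/-- This avoids proving that `Ω ∩ nonzeroCoords n` is connected. Constants found on small
neighbourhoods agree on overlaps, since nonempty open sets meet the dense set `nonzeroCoords n`; a
locally constant function on the connected `Ω` is constant. -/
theorem exists_eq_mul_monomial_on_nonzeroCoords {n : ℕ} {Ω : Set (Fin n → ℂ)} (hΩ : IsOpen Ω)
    (hΩc : IsPreconnected Ω) {F : (Fin n → ℂ) → ℂ}
    (hF : DifferentiableOn ℂ F Ω) {α : Fin n → ℤ}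
    (hE : ∀ z ∈ Ω, ∀ j, z j * pderiv j F z = α j * F z) :
    ∃ c, ∀ z ∈ Ω, z ∈ nonzeroCoords n → F z = c * monomial α z := by
  have hloc : ∀ p : Ω, ∃ V ⊆ Ω, IsOpen V ∧ p.1 ∈ V ∧
      ∃ c, ∀ z ∈ V ∩ nonzeroCoords n, F z = c * monomial α z := by
    intro p
    obtain ⟨V, hVΩ, hV, hpV, hVc⟩ := exists_isOpen_isPreconnected_inter_nonzeroCoords hΩ p.2
    exact ⟨V, hVΩ, hV, hpV, exists_eq_mul_monomial_of_isPreconnected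
      (hV.inter (isOpen_nonzeroCoords n)) hVc Set.inter_subset_right
      (hF.mono (Set.inter_subset_left.trans hVΩ)) fun z hz => hE z (hVΩ hz.1)⟩
  choose V hVΩ hV hpV c hc using hloc
  have hlc : IsLocallyConstant c := by
    refine (IsLocallyConstant.iff_exists_open c).2 fun p =>
      ⟨Subtype.val ⁻¹' V p, (hV p).preimage continuous_subtype_val, hpV p, fun q hq => ?_⟩
    obtain ⟨w, hw, hw0⟩ := (dense_nonzeroCoords n).inter_open_nonempty _ ((hV p).inter (hV q))
      ⟨q.1, hq, hpV q⟩
    have h := (hc q w ⟨hw.2, hw0⟩).symm.trans (hc p w ⟨hw.1, hw0⟩)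
    exact mul_right_cancel₀ (monomial_ne_zero α hw0) h
  have : PreconnectedSpace Ω := isPreconnected_iff_preconnectedSpace.1 hΩc
  rcases Ω.eq_empty_or_nonempty with rfl | ⟨p, hp⟩
  · exact ⟨0, fun z hz => hz.elim⟩
  · refine ⟨c ⟨p, hp⟩, fun z hz hz0 => ?_⟩
    rw [hc ⟨z, hz⟩ z ⟨hpV ⟨z, hz⟩, hz0⟩, hlc.apply_eq_of_preconnectedSpace ⟨p, hp⟩ ⟨z, hz⟩]

theorem eqOn_of_eqOn_nonzeroCoords {n : ℕ} {Ω : Set (Fin n → ℂ)} (hΩ : IsOpen Ω)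
    {F G : (Fin n → ℂ) → ℂ} (hF : ContinuousOn F Ω) (hG : ContinuousOn G Ω)
    (h : ∀ z ∈ Ω, z ∈ nonzeroCoords n → F z = G z) : Set.EqOn F G Ω := by
  refine Set.EqOn.of_subset_closure (s := Ω ∩ nonzeroCoords n) (fun z hz => h z hz.1 hz.2) hF hG
    Set.inter_subset_left ?_
  exact (dense_nonzeroCoords n).open_subset_closure_inter hΩ

/-- A holomorphic function that satisfies Euler's identities is a multiple of a monomial. -/
theorem exists_eq_mul_monomial {n : ℕ} {Ω : Set (Fin n → ℂ)} (hΩ : IsOpen Ω)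
    (hΩc : IsPreconnected Ω) {F : (Fin n → ℂ) → ℂ}
    (hF : DifferentiableOn ℂ F Ω) {α : Fin n → ℤ}
    (hE : ∀ z ∈ Ω, ∀ j, z j * pderiv j F z = α j * F z) :
    AnalyticOnNhd ℂ F Ω ∧ ∃ c, ∀ z ∈ Ω, F z = c * monomial α z := by
  obtain ⟨c, hc⟩ := exists_eq_mul_monomial_on_nonzeroCoords hΩ hΩc hF hE
  -- Off the coordinate hyperplanes `z^α = P / N` with `P` and `N` entire; the cleared identity `F N
  -- = c P` extends to `Ω` by continuity.
  let P : (Fin n → ℂ) → ℂ := monomial fun j => max (α j) 0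
  let N : (Fin n → ℂ) → ℂ := monomial fun j => max (-α j) 0
  have hP : Continuous P := continuous_iff_continuousAt.2 fun z =>
    (analyticAt_monomial fun j => Or.inr (le_max_right _ _)).continuousAt
  have hN : Continuous N := continuous_iff_continuousAt.2 fun z =>
    (analyticAt_monomial fun j => Or.inr (le_max_right _ _)).continuousAt
  have hMN : ∀ z : Fin n → ℂ, (∀ j, z j ≠ 0 ∨ 0 ≤ α j) → monomial α z * N z = P z := by
    intro z hz
    simp only [N, P, monomial, ← Finset.prod_mul_distrib]
    refine Finset.prod_congr rfl fun j _ => ?_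
    rcases hz j with h | h
    · rw [← zpow_add₀ h]
      congr 1
      rcases le_total (α j) 0 with h' | h'
      · rw [max_eq_left (by lia), max_eq_right h']; lia
      · rw [max_eq_right (by lia), max_eq_left h']; lia
    · rw [max_eq_right (by lia), max_eq_left h]; simp
  have hH : Set.EqOn (fun z => F z * N z) (fun z => c * P z) Ω := by
    refine eqOn_of_eqOn_nonzeroCoords hΩ (hF.continuousOn.mul hN.continuousOn)
      (continuousOn_const.mul hP.continuousOn) fun z hz hz0 => ?_
    rw [hc z hz hz0, mul_assoc, hMN z fun j => Or.inl (hz0 j)]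
  have hformula : ∀ z ∈ Ω, F z = c * monomial α z := by
    intro z hz
    by_cases hbad : ∀ j, z j ≠ 0 ∨ 0 ≤ α j
    · have hNz : N z ≠ 0 := by
        refine Finset.prod_ne_zero_iff.2 fun j _ => ?_
        rcases hbad j with h | h
        · exact zpow_ne_zero _ h
        · simp [max_eq_right (neg_nonpos.2 h)]
      apply mul_right_cancel₀ hNz
      rw [mul_assoc, hMN z hbad]
      exact hH hz
    -- Here `zⱼ = 0` and `αⱼ < 0`. Euler's identity gives `F z = 0`, and the monomial is `0` too by
    -- the convention that `0` to a nonzero integer power is `0`.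
    · push Not at hbad
      obtain ⟨j, hj0, hj⟩ := hbad
      have h1 := hE z hz j
      rw [hj0, zero_mul, eq_comm, mul_eq_zero, Int.cast_eq_zero] at h1
      have hM : monomial α z = 0 :=
        Finset.prod_eq_zero (Finset.mem_univ j) (by rw [hj0, zero_zpow _ hj.ne])
      rw [hM, mul_zero]
      exact h1.resolve_left hj.ne
  refine ⟨?_, c, hformula⟩
  -- If `c = 0`, `Ω` may contain poles of `z^α`, but `F` vanishes. If `c ≠ 0`, there is no pole in
  -- `Ω`: at a generic point of the hyperplane `zⱼ = 0` in `Ω`, `F N = c P` would have `N = 0` and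
  -- `P ≠ 0`.
  by_cases hc0 : c = 0
  · intro z hz
    refine (analyticAt_const (v := (0 : ℂ))).congr ?_
    filter_upwards [hΩ.mem_nhds hz] with w hw
    rw [hformula w hw, hc0, zero_mul]
  · intro z hz
    have hgood : ∀ j, z j ≠ 0 ∨ 0 ≤ α j := by
      by_contra hbad
      push Not at hbad
      obtain ⟨j, hj0, hj⟩ := hbad
      have hcont : Continuous fun w : Fin n → ℂ => Function.update w j 0 :=
        continuous_id.update j continuous_const
      have hmem : {w : Fin n → ℂ | Function.update w j 0 ∈ Ω}.Nonempty := by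
        refine ⟨z, ?_⟩
        rw [Set.mem_ofPred_eq, ← hj0, Function.update_eq_self]
        exact hz
      obtain ⟨w, hw, hw0⟩ :=
        (dense_nonzeroCoords n).inter_open_nonempty _ (hΩ.preimage hcont) hmem
      have h1 := hH hw
      have hN0 : N (Function.update w j 0) = 0 := by
        refine Finset.prod_eq_zero (Finset.mem_univ j) ?_
        rw [Function.update_self, zero_zpow]
        exact (lt_max_of_lt_left (by lia : 0 < -α j)).ne'
      have hP0 : P (Function.update w j 0) ≠ 0 := by
        refine Finset.prod_ne_zero_iff.2 fun i _ => ?_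
        by_cases hij : i = j
        · subst hij
          simp [max_eq_right hj.le]
        · rw [Function.update_of_ne hij]
          exact zpow_ne_zero _ (hw0 i)
      simp only [hN0, mul_zero, zero_eq_mul] at h1
      exact h1.elim hc0 hP0
    refine ((analyticAt_const (v := c)).mul (analyticAt_monomial hgood)).congr ?_
    filter_upwards [hΩ.mem_nhds hz] with w hw
    exact (hformula w hw).symm

/-! ### Decay of the homogeneous components -/

/-- `g` and its iterated partial derivatives of order at most `k` are bounded on each
`Ω ∩ P_m`. -/
def BoundedDerivs {n : ℕ} (Ω : Set (Fin n → ℂ)) : ℕ → ((Fin n → ℂ) → ℂ) → Prop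
  | 0, g => ∀ m, ∃ C, ∀ z ∈ Ω ∩ polydisc n m, ‖g z‖ ≤ C
  | k + 1, g => (∀ m, ∃ C, ∀ z ∈ Ω ∩ polydisc n m, ‖g z‖ ≤ C) ∧
      ∀ j, BoundedDerivs Ω k (pderiv j g)

namespace BoundedDerivs

variable {n : ℕ} {Ω : Set (Fin n → ℂ)} {g h : (Fin n → ℂ) → ℂ} {k : ℕ}

theorem bounded (hg : BoundedDerivs Ω k g) (m : ℕ) :
    ∃ C, ∀ z ∈ Ω ∩ polydisc n m, ‖g z‖ ≤ C := by
  cases k with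
  | zero => exact hg m
  | succ k => exact hg.1 m

theorem of_succ (hg : BoundedDerivs Ω (k + 1) g) : BoundedDerivs Ω k g := by
  induction k generalizing g with
  | zero => exact hg.1
  | succ k ih => exact ⟨hg.1, fun j => ih (hg.2 j)⟩

theorem congr (hΩ : IsOpen Ω) (hgh : Set.EqOn g h Ω) (hg : BoundedDerivs Ω k g) :
    BoundedDerivs Ω k h := by
  have hb : ∀ m, ∃ C, ∀ z ∈ Ω ∩ polydisc n m, ‖h z‖ ≤ C := fun m => by
    obtain ⟨C, hC⟩ := hg.bounded m
    exact ⟨C, fun z hz => hgh hz.1 ▸ hC z hz⟩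
  induction k generalizing g h with
  | zero => exact hb
  | succ k ih =>
    have hd := fun j => pderiv_eqOn hΩ j hgh
    exact ⟨hb, fun j => ih (hd j) (hg.2 j) fun m => by
      obtain ⟨C, hC⟩ := (hg.2 j).bounded m
      exact ⟨C, fun z hz => hd j hz.1 ▸ hC z hz⟩⟩

theorem add (hΩ : IsOpen Ω) (hga : AnalyticOnNhd ℂ g Ω) (hha : AnalyticOnNhd ℂ h Ω)
    (hg : BoundedDerivs Ω k g) (hh : BoundedDerivs Ω k h) :
    BoundedDerivs Ω k (g + h) := by
  have hb : ∀ {u v : (Fin n → ℂ) → ℂ}, BoundedDerivs Ω 0 u → BoundedDerivs Ω 0 v →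
      BoundedDerivs Ω 0 (u + v) := fun hu hv m => by
    obtain ⟨C, hC⟩ := hu m
    obtain ⟨D, hD⟩ := hv m
    exact ⟨C + D, fun z hz => (norm_add_le _ _).trans (add_le_add (hC z hz) (hD z hz))⟩
  induction k generalizing g h with
  | zero => exact hb hg hh
  | succ k ih =>
    refine ⟨hb hg.1 hh.1, fun j => ?_⟩
    refine congr hΩ (fun z hz => ?_) (ih (analyticOnNhd_pderiv j hga) (analyticOnNhd_pderiv j hha)
      (hg.2 j) (hh.2 j))
    have := (pderiv_linear j 1 (hga z hz) (hha z hz)).eq_of_nhds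
    simpa using this.symm

end BoundedDerivs

theorem analyticAt_coord {n : ℕ} (i : Fin n) (z : Fin n → ℂ) :
    AnalyticAt ℂ (fun w : Fin n → ℂ => w i) z :=
  (ContinuousLinearMap.proj (R := ℂ) (φ := fun _ : Fin n => ℂ) i).analyticAt z

theorem pderiv_coord_mul {n : ℕ} (i j : Fin n) {g : (Fin n → ℂ) → ℂ} {z : Fin n → ℂ}
    (hg : AnalyticAt ℂ g z) :
    pderiv j (fun w => w i * g w) z =
      z i * pderiv j g z + (if i = j then g z else 0) := by
  have h1 : HasFDerivAt (fun w : Fin n → ℂ => w i)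
      (ContinuousLinearMap.proj (R := ℂ) (φ := fun _ : Fin n => ℂ) i) z :=
    (ContinuousLinearMap.proj (R := ℂ) (φ := fun _ : Fin n => ℂ) i).hasFDerivAt
  have h2 : HasFDerivAt (fun w => w i * g w) _ z := h1.mul hg.differentiableAt.hasFDerivAt
  rw [pderiv, h2.fderiv]
  by_cases hij : i = j
  · subst hij
    simp [pderiv]
  · simp [pderiv, hij]

namespace BoundedDerivs

variable {n : ℕ} {Ω : Set (Fin n → ℂ)} {g : (Fin n → ℂ) → ℂ} {k : ℕ}

/-- The coordinates are bounded only on the polydiscs, which is why boundedness is asked on each `Ω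
∩ P_m`. The extra term `g` of the product rule needs one order less. -/
theorem coord_mul (hΩ : IsOpen Ω) (hga : AnalyticOnNhd ℂ g Ω) (hg : BoundedDerivs Ω k g)
    (i : Fin n) : BoundedDerivs Ω k (fun w => w i * g w) := by
  have hb : ∀ {u : (Fin n → ℂ) → ℂ}, BoundedDerivs Ω 0 u →
      BoundedDerivs Ω 0 (fun w => w i * u w) := fun hu m => by
    obtain ⟨C, hC⟩ := hu m
    refine ⟨m * C, fun z hz => ?_⟩
    rw [norm_mul]
    exact mul_le_mul (hz.2 i).le (hC z hz) (norm_nonneg _) (Nat.cast_nonneg m)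
  induction k generalizing g with
  | zero => exact hb hg
  | succ k ih =>
    refine ⟨hb hg.1, fun j => ?_⟩
    have h1 := ih (analyticOnNhd_pderiv j hga) (hg.2 j)
    have h1a : AnalyticOnNhd ℂ (fun w : Fin n → ℂ => w i * pderiv j g w) Ω := fun z hz =>
      (analyticAt_coord i z).mul (analyticAt_pderiv j (hga z hz))
    by_cases hij : i = j
    · refine congr hΩ (fun z hz => ?_) (h1.add hΩ h1a hga hg.of_succ)
      rw [pderiv_coord_mul i j (hga z hz), if_pos hij]
      rfl
    · refine congr hΩ (fun z hz => ?_) h1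
      rw [pderiv_coord_mul i j (hga z hz), if_neg hij, add_zero]

end BoundedDerivs

/-- The operator `zⱼ ∂/∂zⱼ`. -/
def eulerOp {n : ℕ} (j : Fin n) (g : (Fin n → ℂ) → ℂ) : (Fin n → ℂ) → ℂ :=
  fun z => z j * pderiv j g z

theorem analyticOnNhd_eulerOp {n : ℕ} {Ω : Set (Fin n → ℂ)} (j : Fin n)
    {g : (Fin n → ℂ) → ℂ} (hg : AnalyticOnNhd ℂ g Ω) : AnalyticOnNhd ℂ (eulerOp j g) Ω :=
  fun z hz => (analyticAt_coord j z).mul (analyticAt_pderiv j (hg z hz))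

/-- Each application of `eulerOp` costs one order of bounded derivatives, so the induction carries
all orders at once. -/
theorem eulerOp_iterate_props {n : ℕ} {Ω : Set (Fin n → ℂ)} (hΩ : IsOpen Ω) (j : Fin n)
    {g : (Fin n → ℂ) → ℂ} (hga : AnalyticOnNhd ℂ g Ω) (hg : ∀ k, BoundedDerivs Ω k g) (N : ℕ) :
    AnalyticOnNhd ℂ ((eulerOp j)^[N] g) Ω ∧ ∀ k, BoundedDerivs Ω k ((eulerOp j)^[N] g) := by
  induction N with
  | zero => exact ⟨hga, hg⟩
  | succ N ih =>
    rw [Function.iterate_succ_apply']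
    exact ⟨analyticOnNhd_eulerOp j ih.1, fun k =>
      BoundedDerivs.coord_mul hΩ (analyticOnNhd_pderiv j ih.1) ((ih.2 (k + 1)).2 j) j⟩

/-- The factor `zⱼ` rotates by `fourier 1 (t j)` and undoes the index shift caused by `∂ⱼ`; Euler's
identity then supplies `αⱼ`. -/
theorem torusCoeff_eulerOp {n : ℕ} {Ω : Set (Fin n → ℂ)} (hΩ : IsOpen Ω)
    (hrot : ∀ t, Set.MapsTo (rot t) Ω Ω) {g : (Fin n → ℂ) → ℂ} (hg : AnalyticOnNhd ℂ g Ω)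
    (α : Fin n → ℤ) (j : Fin n) {z : Fin n → ℂ} (hz : z ∈ Ω) :
    torusCoeff (eulerOp j g) α z = α j * torusCoeff g α z := by
  rw [← euler_torusCoeff hΩ hrot hg α j hz, pderiv_torusCoeff hΩ hrot hg α j hz, torusCoeff_eq,
    torusCoeff_eq, ← integral_const_mul]
  congr 1
  ext t
  rw [← mFourier_neg_mul_fourier_one]
  simp only [eulerOp, rot]
  ring

theorem torusCoeff_eulerOp_iterate {n : ℕ} {Ω : Set (Fin n → ℂ)} (hΩ : IsOpen Ω)
    (hrot : ∀ t, Set.MapsTo (rot t) Ω Ω) {g : (Fin n → ℂ) → ℂ} (hg : AnalyticOnNhd ℂ g Ω)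
    (α : Fin n → ℤ) (j : Fin n) (N : ℕ) {z : Fin n → ℂ} (hz : z ∈ Ω) :
    torusCoeff ((eulerOp j)^[N] g) α z = (α j : ℂ) ^ N * torusCoeff g α z := by
  induction N generalizing g with
  | zero => simp
  | succ N ih =>
    rw [Function.iterate_succ_apply, ih (analyticOnNhd_eulerOp j hg),
      torusCoeff_eulerOp hΩ hrot hg α j hz]
    ring

theorem exists_norm_torusCoeff_le {n : ℕ} (hn : 1 ≤ n) {Ω : Set (Fin n → ℂ)}
    (hΩ : IsReinhardtDomain Ω) {g : (Fin n → ℂ) → ℂ} (hga : AnalyticOnNhd ℂ g Ω)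
    (hg : ∀ k, BoundedDerivs Ω k g) (m N : ℕ) :
    ∃ C, ∀ z ∈ Ω ∩ polydisc n m, ∀ α : Fin n → ℤ,
      ‖torusCoeff g α z‖ ≤ C * (1 + ‖α‖ ^ N)⁻¹ := by
  have : Nonempty (Fin n) := ⟨⟨0, hn⟩⟩
  obtain ⟨C₀, hC₀⟩ := (hg 0).bounded m
  choose C hC using fun j => ((eulerOp_iterate_props hΩ.isOpen j hga hg N).2 0).bounded m
  -- `C₀` pays for the summand `1`; the sum pays for `‖α‖ ^ N`, whichever coordinate `αⱼ` attains
  -- the sup norm.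
  refine ⟨C₀ + ∑ j, |C j|, fun z hz α => ?_⟩
  have h0 : ‖torusCoeff g α z‖ ≤ C₀ :=
    norm_torusCoeff_le (fun t => hC₀ _ (hΩ.rot_mem_inter t m hz)) α
  obtain ⟨j, hj⟩ := Finite.exists_max fun j => ‖α j‖
  have hα : ‖α‖ ≤ ‖α j‖ := (pi_norm_le_iff_of_nonneg (norm_nonneg _)).2 hj
  have h1 : ‖α j‖ ^ N * ‖torusCoeff g α z‖ ≤ C j := by
    have h := norm_torusCoeff_le (fun t => hC j _ (hΩ.rot_mem_inter t m hz)) α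
    rw [torusCoeff_eulerOp_iterate hΩ.isOpen hΩ.rot_mem hga α j N hz.1, norm_mul, norm_pow] at h
    simpa [Int.norm_eq_abs] using h
  have h2 : ‖α‖ ^ N * ‖torusCoeff g α z‖ ≤ ∑ j, |C j| :=
    calc ‖α‖ ^ N * ‖torusCoeff g α z‖ ≤ ‖α j‖ ^ N * ‖torusCoeff g α z‖ := by gcongr
      _ ≤ |C j| := h1.trans (le_abs_self _)
      _ ≤ ∑ j, |C j| := Finset.single_le_sum (f := fun j => |C j|) (fun _ _ => abs_nonneg _)
          (Finset.mem_univ j)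
  rw [← div_eq_mul_inv, le_div_iff₀ (by positivity)]
  linarith

/-- Comparison with the sum of `‖v‖⁻¹ ^ (n + 1)` over the lattice `ℤⁿ` in `ℝⁿ`, whose exponent
exceeds the rank. -/
theorem summable_inv_one_add_norm_pow (n : ℕ) :
    Summable fun α : Fin n → ℤ => (1 + ‖α‖ ^ (n + 1))⁻¹ := by
  let L : Submodule ℤ (Fin n → ℝ) := Submodule.span ℤ (Set.range (Pi.basisFun ℝ (Fin n)))
  let φ : (Fin n → ℤ) → L := fun α => ⟨fun j => (α j : ℝ), by
    refine ((Pi.basisFun ℝ (Fin n)).mem_span_iff_repr_mem ℤ _).2 fun j => ⟨α j, ?_⟩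
    simp⟩
  have hφ : Function.Injective φ := fun α β h => by
    ext j
    exact Int.cast_injective (α := ℝ) (congrFun (congrArg Subtype.val h) j)
  have hnorm : ∀ α, ‖φ α‖ = ‖α‖ := fun α => by
    change ‖fun j => (α j : ℝ)‖ = ‖α‖
    rfl
  have hrank : Module.finrank ℤ L < n + 1 := by
    rw [ZLattice.rank ℝ L]
    simp
  have h := (ZLattice.summable_norm_pow_inv L (n + 1) hrank).comp_injective hφ
  refine Summable.of_norm_bounded_eventually h ?_
  -- The origin is excluded: there the majorant is `0` because `0⁻¹ = 0`, while the term is `1`.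
  filter_upwards [(Set.finite_singleton (0 : Fin n → ℤ)).compl_mem_cofinite] with α hα
  have hpos : 0 < ‖α‖ := norm_pos_iff.2 hα
  rw [Function.comp_apply, hnorm, inv_pow, Real.norm_of_nonneg (by positivity)]
  exact inv_anti₀ (by positivity) (by linarith)

/-! ### The coefficients as torus integrals -/

-- At the point `(|wⱼ|)` the orbit is parametrized exactly as in `torusIntegral`, up to the
-- substitution `θ = 2πt`, so no phase of `w` enters.
open scoped Pointwise in
theorem torusCoeff_norm_eq {n : ℕ} {Ω : Set (Fin n → ℂ)} (f : Ω → ℂ) {w : Fin n → ℂ}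
    (hw : w ∈ nonzeroCoords n) (α : Fin n → ℤ) :
    torusCoeff (zeroExt f) α (fun j => (‖w j‖ : ℂ)) =
      laurentCoeff f w α * monomial α (fun j => (‖w j‖ : ℂ)) := by
  set R : Fin n → ℝ := fun j => ‖w j‖ with hR
  have hR0 : ∀ j, (R j : ℂ) ≠ 0 := fun j => by simpa [hR] using hw j
  let Ψ : (Fin n → ℝ) → ℂ := fun θ =>
    (∏ j, Complex.exp (θ j * Complex.I) ^ (-α j)) * zeroExt f (torusMap 0 R θ)
  have hset : (2 * Real.pi) • {x : Fin n → ℝ | ∀ i, x i ∈ Set.Ioc (0 : ℝ) (0 + 1)} =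
      Set.univ.pi fun _ => Set.Ioc 0 (2 * Real.pi) := by
    ext x
    rw [Set.mem_smul_set_iff_inv_smul_mem₀ (by positivity)]
    simp only [Set.mem_ofPred_eq, Set.mem_univ_pi, Pi.smul_apply, smul_eq_mul, Set.mem_Ioc]
    refine forall_congr' fun i => and_congr ?_ ?_
    · exact mul_pos_iff_of_pos_left (by positivity)
    · rw [inv_mul_le_iff₀ (by positivity)]
      simp
  have h1 : torusCoeff (zeroExt f) α (fun j => (R j : ℂ)) =
      (((2 * Real.pi) ^ n)⁻¹ : ℝ) • ∫ θ in Set.Icc (0 : Fin n → ℝ) (fun _ => 2 * Real.pi), Ψ θ := by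
    rw [torusCoeff, mFourierCoeff_eq_integral _ _ 0]
    have hc := Measure.setIntegral_comp_smul_of_pos (volume : Measure (Fin n → ℝ)) Ψ
      {x : Fin n → ℝ | ∀ i, x i ∈ Set.Ioc (0 : ℝ) (0 + 1)} (R := 2 * Real.pi) (by positivity)
    have hae : (Set.univ.pi fun _ : Fin n => Set.Ioc 0 (2 * Real.pi)) =ᵐ[volume]
        Set.Icc (0 : Fin n → ℝ) (fun _ => 2 * Real.pi) := Measure.univ_pi_Ioc_ae_eq_Icc
    rw [hset, setIntegral_congr_set hae, Module.finrank_fin_fun] at hc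
    refine Eq.trans ?_ hc
    refine integral_congr_ae (Eventually.of_forall fun x => ?_)
    have he : ∀ j, ((fourier 1 (x j : UnitAddCircle) : ℂ)) =
        Complex.exp (((2 * Real.pi) • x) j * Complex.I) := by
      intro j
      rw [fourier_coe_apply]
      congr 1
      simp
      ring
    simp only [Ψ, smul_eq_mul]
    congr 1
    · simp only [mFourier, ContinuousMap.coe_mk]
      refine Finset.prod_congr rfl fun j _ => ?_
      rw [fourier_coe_apply, ← Complex.exp_int_mul]
      congr 1
      simp
      ring
    · congr 1
      ext j
      simp only [rot, torusMap]
      rw [he]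
      simp
      ring
  -- The Jacobian factor `i ζⱼ` cancels one power in `ζⱼ ^ (αⱼ + 1)`; what remains is a constant
  -- times the Fourier integrand.
  have h2 : ∀ θ : Fin n → ℝ, (∏ i, (R i : ℂ) * Complex.exp (θ i * Complex.I) * Complex.I) •
      (zeroExt f (torusMap 0 R θ) / ∏ j, torusMap 0 R θ j ^ (α j + 1)) =
      (Complex.I ^ n * (monomial α fun j => (R j : ℂ))⁻¹) * Ψ θ := by
    intro θ
    have hj : ∀ j, (R j : ℂ) * Complex.exp (θ j * Complex.I) * Complex.I /
        torusMap 0 R θ j ^ (α j + 1) =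
        Complex.I * ((R j : ℂ) ^ α j)⁻¹ * Complex.exp (θ j * Complex.I) ^ (-α j) := by
      intro j
      have hne := Complex.exp_ne_zero (θ j * Complex.I)
      have := hR0 j
      simp only [torusMap, Pi.zero_apply, zero_add]
      rw [zpow_add_one₀ (mul_ne_zero this hne), mul_zpow, zpow_neg]
      field_simp
    rw [smul_eq_mul, mul_div_assoc', mul_div_right_comm, ← Finset.prod_div_distrib]
    simp_rw [hj]
    rw [Finset.prod_mul_distrib, Finset.prod_mul_distrib, Finset.prod_inv_distrib]
    simp only [Finset.prod_const, Finset.card_univ, Fintype.card_fin, Ψ, monomial]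
    ring
  have hM : (monomial α fun j => (R j : ℂ)) ≠ 0 := monomial_ne_zero α hR0
  have h3 : torusIntegral (fun ζ => zeroExt f ζ / ∏ j, ζ j ^ (α j + 1)) 0 R =
      ∫ θ in Set.Icc (0 : Fin n → ℝ) (fun _ => 2 * Real.pi),
        (Complex.I ^ n * (monomial α fun j => (R j : ℂ))⁻¹) * Ψ θ :=
    integral_congr_ae (Eventually.of_forall h2)
  rw [h1, laurentCoeff, h3, integral_const_mul, Complex.real_smul]
  push_cast
  have hpi : (Real.pi : ℂ) ≠ 0 := by exact_mod_cast Real.pi_ne_zero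
  rw [mul_pow (2 * (Real.pi : ℂ)) Complex.I n]
  have hI : (Complex.I ^ n) ≠ 0 := pow_ne_zero _ Complex.I_ne_zero
  have h2pi : (2 * (Real.pi : ℂ)) ^ n ≠ 0 := pow_ne_zero _ (mul_ne_zero two_ne_zero hpi)
  field_simp
  simp only [hR]

/-! ### The Laurent series in `𝒜^∞(Ω)` -/

variable {n : ℕ} {Ω : Set (Fin n → ℂ)}

theorem AInfty.boundedDerivs_mderiv (hΩ : IsOpen Ω) (f : AInfty Ω) (k : ℕ) (β : Fin n → ℕ) :
    BoundedDerivs Ω k (mderiv β (zeroExt f.toFun)) := by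
  have hb : ∀ β : Fin n → ℕ, BoundedDerivs Ω 0 (mderiv β (zeroExt f.toFun)) := fun β m => by
    obtain ⟨C, hC⟩ := bddAbove_ckNorm (∑ j, β j) m f
    exact ⟨C, fun z hz => hC ⟨(⟨β, le_rfl⟩, ⟨z, hz⟩), rfl⟩⟩
  induction k generalizing β with
  | zero => exact hb β
  | succ k ih =>
    exact ⟨hb β, fun j => (ih (β + Pi.single j 1)).congr hΩ
      (pderiv_mderiv hΩ β j f.isAInfty.holo).symm⟩

theorem torusCoeff_zeroExt (hΩ : IsReinhardtDomain Ω) (f : AInfty Ω) (α : Fin n → ℤ) :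
    AnalyticOnNhd ℂ (torusCoeff (zeroExt f.toFun) α) Ω ∧
      ∃ c, ∀ z ∈ Ω, torusCoeff (zeroExt f.toFun) α z = c * monomial α z :=
  exists_eq_mul_monomial hΩ.isOpen hΩ.isConnected.isPreconnected
    (differentiableOn_torusCoeff hΩ.isOpen hΩ.rot_mem f.isAInfty.holo α)
    fun _ hz j => euler_torusCoeff hΩ.isOpen hΩ.rot_mem f.isAInfty.holo α j hz

theorem mderiv_zeroExt_torusCoeff (hΩ : IsReinhardtDomain Ω) (f : AInfty Ω) (α : Fin n → ℤ)
    (β : Fin n → ℕ) :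
    Set.EqOn (mderiv β (zeroExt fun z : Ω => torusCoeff (zeroExt f.toFun) α z))
      (torusCoeff (mderiv β (zeroExt f.toFun)) (α - fun j => (β j : ℤ))) Ω :=
  (mderiv_eqOn hΩ.isOpen β (zeroExt_eqOn _)).trans
    (mderiv_torusCoeff hΩ.isOpen hΩ.rot_mem f.isAInfty.holo α β)

theorem isAInfty_torusCoeff (hΩ : IsReinhardtDomain Ω) (f : AInfty Ω) (α : Fin n → ℤ) :
    IsAInfty Ω fun z : Ω => torusCoeff (zeroExt f.toFun) α z where
  holo := (torusCoeff_zeroExt hΩ f α).1.congr hΩ.isOpen (zeroExt_eqOn _).symm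
  ext β := by
    obtain ⟨G, hG, hGf⟩ := f.isAInfty.ext β
    refine ⟨torusCoeff G (α - fun j => (β j : ℤ)), continuousOn_torusCoeff hΩ.rot_mem_closure hG _,
      fun z hz => ?_⟩
    rw [mderiv_zeroExt_torusCoeff hΩ f α β hz]
    exact torusCoeff_congr (fun t => hGf _ (hΩ.rot_mem t hz)) _

/-- The term of exponent `α` of the Laurent series of `f`. -/
def laurentTerm (hΩ : IsReinhardtDomain Ω) (f : AInfty Ω) (α : Fin n → ℤ) : AInfty Ω :=
  ⟨fun z => torusCoeff (zeroExt f.toFun) α z, isAInfty_torusCoeff hΩ f α⟩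

theorem mderiv_laurentTerm (hΩ : IsReinhardtDomain Ω) (f : AInfty Ω) (α : Fin n → ℤ)
    (β : Fin n → ℕ) : Set.EqOn (mderiv β (zeroExt (laurentTerm hΩ f α).toFun))
      (torusCoeff (mderiv β (zeroExt f.toFun)) (α - fun j => (β j : ℤ))) Ω :=
  mderiv_zeroExt_torusCoeff hΩ f α β

/-! ### Summable majorants and convergence -/

theorem exists_norm_torusCoeff_mderiv_le (hn : 1 ≤ n) (hΩ : IsReinhardtDomain Ω) (f : AInfty Ω)
    (β : Fin n → ℕ) (m : ℕ) :
    ∃ C, ∀ z ∈ Ω ∩ polydisc n m, ∀ γ : Fin n → ℤ,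
      ‖torusCoeff (mderiv β (zeroExt f.toFun)) γ z‖ ≤ C * (1 + ‖γ‖ ^ (n + 1))⁻¹ :=
  exists_norm_torusCoeff_le hn hΩ (analyticOnNhd_mderiv β f.isAInfty.holo)
    (fun k => f.boundedDerivs_mderiv hΩ.isOpen k β) m (n + 1)

theorem exists_summable_bound_laurentTerm (hn : 1 ≤ n) (hΩ : IsReinhardtDomain Ω) (f : AInfty Ω)
    (k m : ℕ) : ∃ b : (Fin n → ℤ) → ℝ, Summable b ∧ (∀ α, 0 ≤ b α) ∧ ∀ α, ∀ p : SupIndex Ω k m,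
      ‖mderiv p.1.1 (zeroExt (laurentTerm hΩ f α).toFun) p.2.1‖ ≤ b α := by
  have : Finite {α : Fin n → ℕ // ∑ j, α j ≤ k} := by
    refine Set.Finite.subset (Set.finite_Iic (fun _ : Fin n => k)) ?_
    intro α hα j
    exact (Finset.single_le_sum (f := α) (fun _ _ => Nat.zero_le _) (Finset.mem_univ j)).trans hα
  have := Fintype.ofFinite {α : Fin n → ℕ // ∑ j, α j ≤ k}
  choose C hC using fun β : Fin n → ℕ => exists_norm_torusCoeff_mderiv_le hn hΩ f β m
  have hnonneg : ∀ (β : Fin n → ℕ) (α : Fin n → ℤ),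
      0 ≤ |C β| * (1 + ‖α - fun j => (β j : ℤ)‖ ^ (n + 1))⁻¹ := fun β α => by positivity
  -- Only finitely many `β` enter the seminorm, so their bounds are added; each is a translate by
  -- `β` of a summable family.
  refine ⟨fun α => ∑ β : {α : Fin n → ℕ // ∑ j, α j ≤ k},
    |C β| * (1 + ‖α - fun j => (β.1 j : ℤ)‖ ^ (n + 1))⁻¹, ?_, ?_, ?_⟩
  · refine summable_sum fun β _ => Summable.mul_left _ ?_
    exact (summable_inv_one_add_norm_pow n).comp_injective
      (sub_left_injective (b := fun j => (β.1 j : ℤ)))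
  · exact fun α => Finset.sum_nonneg fun β _ => hnonneg β.1 α
  · rintro α ⟨β, z, hz⟩
    rw [mderiv_laurentTerm hΩ f α β.1 hz.1]
    refine (hC β.1 z hz _).trans (le_trans ?_ (Finset.single_le_sum
      (f := fun β : {α : Fin n → ℕ // ∑ j, α j ≤ k} =>
        |C β| * (1 + ‖α - fun j => (β.1 j : ℤ)‖ ^ (n + 1))⁻¹)
      (fun β _ => hnonneg β.1 α) (Finset.mem_univ β)))
    gcongr
    exact le_abs_self _

theorem hasSum_mderiv_laurentTerm (hn : 1 ≤ n) (hΩ : IsReinhardtDomain Ω) (f : AInfty Ω)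
    (β : Fin n → ℕ) {z : Fin n → ℂ} (hz : z ∈ Ω) :
    HasSum (fun α => mderiv β (zeroExt (laurentTerm hΩ f α).toFun) z)
      (mderiv β (zeroExt f.toFun) z) := by
  obtain ⟨m, hm⟩ := exists_nat_gt ‖z‖
  obtain ⟨C, hC⟩ := exists_norm_torusCoeff_mderiv_le hn hΩ f β m
  let F : C(UnitAddTorus (Fin n), ℂ) := ⟨fun t => mderiv β (zeroExt f.toFun) (rot t z),
    continuousOn_univ.1 ((analyticOnNhd_mderiv β f.isAInfty.holo).continuousOn.comp
      (continuous_rot.comp (Continuous.prodMk_right z)).continuousOn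
      fun t _ => hΩ.rot_mem t hz)⟩
  have hF : ∀ γ, mFourierCoeff F γ = torusCoeff (mderiv β (zeroExt f.toFun)) γ z := fun γ => rfl
  have hs : Summable (mFourierCoeff F) :=
    Summable.of_norm_bounded ((summable_inv_one_add_norm_pow n).mul_left C) fun γ =>
      hC z ⟨hz, fun j => (norm_le_pi_norm z j).trans_lt hm⟩ γ
  have h := hasSum_mFourier_series_apply_of_summable hs 0
  have h0 : ∀ γ : Fin n → ℤ, mFourier γ (0 : UnitAddTorus (Fin n)) = 1 := fun γ => by
    simp [mFourier]
  have hF0 : F 0 = mderiv β (zeroExt f.toFun) z := by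
    change mderiv β (zeroExt f.toFun) (rot 0 z) = _
    rw [rot_zero]
  simp only [h0, hF, hF0, smul_eq_mul, mul_one] at h
  -- The `α`-th term contributes the Fourier coefficient of index `α - β`, hence the reindexing.
  have h' := (Equiv.subRight (fun j => (β j : ℤ))).hasSum_iff.2 h
  refine h'.congr_fun fun α => ?_
  exact mderiv_laurentTerm hΩ f α β hz

/-- Evaluation of `D^β` at a point of `Ω`, as a linear map on `𝒜^∞(Ω)`. -/
def mderivEval (β : Fin n → ℕ) (z : Ω) : AInfty Ω →ₗ[ℂ] ℂ where
  toFun f := mderiv β (zeroExt f.toFun) z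
  map_add' f g := by
    rw [AInfty.toFun_add, zeroExt_add, mderiv_add _ (f.isAInfty.holo _ z.2) (g.isAInfty.holo _ z.2)]
  map_smul' a f := by
    rw [AInfty.toFun_smul, zeroExt_smul, mderiv_smul _ a (f.isAInfty.holo _ z.2)]
    rfl

theorem hasSum_laurentTerm (hn : 1 ≤ n) (hΩ : IsReinhardtDomain Ω) (f : AInfty Ω) :
    HasSum (laurentTerm hΩ f) f := by
  refine ((withSeminorms_ckFamily Ω).tendsto_nhds _ f).2 ?_
  rintro ⟨k, m⟩ ε hε
  obtain ⟨b, hb, hb0, hbound⟩ := exists_summable_bound_laurentTerm hn hΩ f k m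
  -- At every point the error of a partial sum is minus the remaining tail, which the tail of `b`
  -- bounds independently of the point and of `β`.
  filter_upwards [(tendsto_tsum_compl_atTop_zero b).eventually (gt_mem_nhds hε)] with s hs
  refine lt_of_le_of_lt (Real.iSup_le (fun p => ?_)
    (tsum_nonneg fun α : {α // α ∉ s} => hb0 α)) hs
  have hz : p.2.1 ∈ Ω := p.2.2.1
  have h := hasSum_mderiv_laurentTerm hn hΩ f p.1.1 hz
  have hsum : ∑ α ∈ s, mderiv p.1.1 (zeroExt (laurentTerm hΩ f α).toFun) p.2.1 +
      ∑' α : {α // α ∉ s}, mderiv p.1.1 (zeroExt (laurentTerm hΩ f α).toFun) p.2.1 =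
      mderiv p.1.1 (zeroExt f.toFun) p.2.1 := by
    rw [h.summable.sum_add_tsum_subtype_compl s, h.tsum_eq]
  have heval : mderiv p.1.1 (zeroExt (∑ α ∈ s, laurentTerm hΩ f α - f).toFun) p.2.1 =
      ∑ α ∈ s, mderiv p.1.1 (zeroExt (laurentTerm hΩ f α).toFun) p.2.1 -
        mderiv p.1.1 (zeroExt f.toFun) p.2.1 := by
    change mderivEval p.1.1 ⟨p.2.1, hz⟩ _ = _
    rw [map_sub, map_sum]
    rfl
  rw [heval, ← hsum, sub_add_cancel_left, norm_neg]
  exact tsum_of_norm_bounded (hb.subtype _).hasSum fun α => hbound α p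

/-- A continuous seminorm is at most a constant times the supremum of finitely many `‖·‖_{k, Ω_m}`,
hence of their sum. -/
theorem summable_seminorm_laurentTerm (hn : 1 ≤ n) (hΩ : IsReinhardtDomain Ω) (f : AInfty Ω)
    (p : Seminorm ℂ (AInfty Ω)) (hp : Continuous p) :
    Summable fun α => p (laurentTerm hΩ f α) := by
  obtain ⟨s, C, -, hC⟩ := Seminorm.bound_of_continuous (withSeminorms_ckFamily Ω) p hp
  have hk : ∀ i : ℕ × ℕ, Summable fun α => ckFamily Ω i (laurentTerm hΩ f α) := by
    rintro ⟨k, m⟩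
    obtain ⟨b, hb, hb0, hbound⟩ := exists_summable_bound_laurentTerm hn hΩ f k m
    exact Summable.of_nonneg_of_le (fun α => apply_nonneg _ _)
      (fun α => Real.iSup_le (hbound α) (hb0 α)) hb
  refine Summable.of_nonneg_of_le (fun α => apply_nonneg _ _) (fun α => ?_)
    ((summable_sum fun i (_ : i ∈ s) => hk i).mul_left (C : ℝ))
  refine (hC _).trans ?_
  rw [smul_apply, NNReal.smul_def, smul_eq_mul]
  refine mul_le_mul_of_nonneg_left ?_ C.2
  exact Seminorm.finset_sup_apply_le (Finset.sum_nonneg fun i _ => apply_nonneg _ _) fun i hi =>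
    Finset.single_le_sum (f := fun i => ckFamily Ω i (laurentTerm hΩ f α))
      (fun i _ => apply_nonneg _ _) hi

/-- Independence of `w` is automatic: one `c` serves on all of `Ω`, and rotating `w` by `|wⱼ| / wⱼ`
puts `(|wⱼ|)` in `Ω`. -/
theorem eq_laurentCoeff (hΩ : IsReinhardtDomain Ω) (f : AInfty Ω) {α : Fin n → ℤ} {c : ℂ}
    (hc : ∀ z ∈ Ω, torusCoeff (zeroExt f.toFun) α z = c * monomial α z) {w : Fin n → ℂ}
    (hw : w ∈ Ω) (hw0 : w ∈ nonzeroCoords n) : c = laurentCoeff f w α := by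
  have hmem : (fun j => (‖w j‖ : ℂ)) ∈ Ω := by
    have h := hΩ.rotate_mem w hw (fun j => ‖w j‖ / w j) fun j => by
      rw [norm_div, Complex.norm_real, norm_norm, div_self (norm_ne_zero_iff.2 (hw0 j))]
    simpa only [div_mul_cancel₀ _ (hw0 _)] using h
  have hne : (monomial α fun j => (‖w j‖ : ℂ)) ≠ 0 :=
    monomial_ne_zero α fun j => by simpa using hw0 j
  exact mul_right_cancel₀ hne ((hc _ hmem).symm.trans (torusCoeff_norm_eq f.toFun hw0 α))

end LaurentAInfty
end

theorem theorem1 {n : ℕ} (hn : 1 ≤ n) (Ω : Set (Fin n → ℂ))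
    (hΩ : LaurentAInfty.IsReinhardtDomain Ω) (f : LaurentAInfty.AInfty Ω) :
    ∃ (c : (Fin n → ℤ) → ℂ) (x : (Fin n → ℤ) → LaurentAInfty.AInfty Ω),
      (∀ w ∈ Ω, (∀ j, w j ≠ 0) → ∀ α, c α = LaurentAInfty.laurentCoeff f w α) ∧
      (∀ α, ∀ z : Ω, x α z = c α * ∏ j, z.1 j ^ α j) ∧
      LaurentAInfty.AbsolutelyConvergent x ∧
      LaurentAInfty.UnconditionallyConvergesTo x f := by
  choose c hc using fun α => (LaurentAInfty.torusCoeff_zeroExt hΩ f α).2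
  refine ⟨c, LaurentAInfty.laurentTerm hΩ f,
    fun w hw hw0 α => LaurentAInfty.eq_laurentCoeff hΩ f (hc α) hw hw0,
    fun α z => hc α z.1 z.2, ?_, fun σ => ?_⟩
  -- `n ≥ 1` makes `Fin n → ℤ` infinite, without which no bijection with `ℕ` exists.
  · have : Nonempty (Fin n) := ⟨⟨0, hn⟩⟩
    obtain ⟨σ⟩ := nonempty_equiv_of_countable (α := ℕ) (β := Fin n → ℤ)
    exact ⟨σ, fun p hp =>
      σ.summable_iff.2 (LaurentAInfty.summable_seminorm_laurentTerm hn hΩ f p hp)⟩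
  · exact (σ.hasSum_iff.2 (LaurentAInfty.hasSum_laurentTerm hn hΩ f)).tendsto_sum_nat
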